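/- **Setting.** Let $A$ be an affine space over a real vector space $L$, with a symplectic potential $\theta:A\times L\to\mathbb{R}$, linear in the second argument, and a bilinear form $[\cdot,\cdot]:L\times L\to\mathbb{R}$ with $\theta(\eta+\xi,\tau)=\theta(\eta,\tau)+[\xi,\tau]$. Put $\omega(\xi,\tau)=\frac12[\xi,\tau]-\frac12[\tau,\xi]$, assumed non-degenerate, $M=\{\tau\in L:[\xi,\tau]=0\ \forall\xi\in L\}$ and $N=\{\tau\in L:[\tau,\xi]=0\ \forall \xi\in L\}$. Assume $L=M+N$ and $\theta(\eta,\tau)=0$ for $\eta\in A$, $\tau\in M$. Let $J:L\to L$ be linear with $J^2=-\mathrm{id}$ and $\omega(J\cdot,J\cdot)=\omega$, such that $g(\tau,\xi)=2\omega(\tau,J\xi)$ makes $L$ a real separable Hilbert space (possibly infinite-dimensional) on which $[\cdot,\cdot]$ is continuous; $A$ carries the induced topology. Put $\{\tau,\xi\}=g(\tau,\xi)+2\mathrm{i}\,\omega(\tau,\xi)$. Let $q:L\to Q=L/M$ be the quotient map, $Q$ with the quotient norm, $j:Q\to L$ the linear section of $q$ with $j(Q)\subseteq JM$, and $\Omega(\phi,\phi')=g(j\phi,j\phi')-\mathrm{i}[j\phi,\phi']$.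 For a space $E$, let $\hat E$ be the algebraic dual of the topological dual of $E$, with the $\sigma$-algebra generated by the evaluations $\hat\phi\mapsto\hat\phi(l)$; $E$ maps canonically to $\hat E$, and continuous linear functionals on $E$ extend canonically to $\hat E$. Let $\nu_Q$ on $\hat Q$ and $\nu_L$ on $\hat L$ be the centered Gaussian measures under which the evaluation at $l$ has variance $\frac12\|l\|^2$, respectively $\|l\|^2$. *Holomorphic representation.* Let $\mathrm{H}^2(\hat L,\nu_L)\subseteq \mathrm{L}^2(\hat L,\nu_L)$ be the closure of the space of square-integrable holomorphic cylinder functions (entire functions of finitely many $\{\tau_i,\cdot\}$). For $f\in\mathrm{H}^2(\hat L,\nu_L)$ its restriction to $L$ is $f|_L(\xi)=\int\overline{\exp(\frac12\{\xi,\cdot\})}\,f\,\mathrm{d}\nu_L$. Put $$\alpha^\eta(\zeta)=\exp\left(\tfrac{\mathrm i}2\theta(\eta,\zeta-\eta)+\tfrac{\mathrm i}2\theta(\zeta,\zeta-\eta)-\tfrac14g(\zeta-\eta,\zeta-\eta)\right).$$ $\mathcal{H}^{\hat H}$ consists of the wave functions $\psi(\zeta)=f|_L(\zeta-\eta)\,\alpha^\eta(\zeta)$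 on $A$, with $\eta\in A$, $f\in\mathrm{H}^2(\hat L,\nu_L)$, and norm $\|f\|$. The affine coherent state of $\zeta\in A$ has the wave function $\hat K^{H}_\zeta=\alpha^\zeta$. *Schrödinger representation.* Given a base point $\eta\in A$, the states of $\mathcal{H}^{\tilde S}$ are presented by $\eta$-reduced wave functions in $\mathrm{L}^2(\hat Q,\nu_Q)$. The $\eta$-reduced wave function of the coherent state of $\zeta\in A$ is, with $d=\eta-\zeta$, $$\hat K^{S,\eta}_\zeta(\phi)=\exp\left(\mathrm i\,\theta(\zeta,d)-\tfrac12\Omega(q(d),q(d))-\mathrm i[d,\phi]-\Omega(q(d),\phi)\right).$$ The presentations $\psi^{S,\eta},\psi^{S,\eta'}$ of a state are related by $\psi^{S,\eta'}(\phi)=\psi^{S,\eta}(\phi+q(\eta'-\eta))\,\hat K^{S,\eta'}_\eta(\phi)$. *Observables.* For a continuous affine $F:A\to\mathbb{R}$ with linear part $F_{\mathrm{lin}}$ let $X_F\in L$ be given by $2\omega(\xi,X_F)=F_{\mathrm{lin}}(\xi)$ for all $\xi\in L$. With $D$ denoting directional derivatives, put $$(\check F\psi)(\zeta)=(F(\zeta)-\theta(\zeta,X_F))\,\psi(\zeta)-\mathrm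 i\,(D_{X_F}\psi)(\zeta)$$ for functions on $A$, and $$(\check F\psi)(\phi)=(F(\eta)-[X_F,\phi]+\mathrm i\,\Omega(q(X_F),\phi))\,\psi(\phi)-\mathrm i\,(D_{q(X_F)}\psi)(\phi)$$ for $\eta$-reduced wave functions on $\hat Q$. Let $\mathcal{H}^{\hat H,cp}$ and $\mathcal{H}^{\tilde S,cp}$ be the spaces spanned by the functions obtained by applying finitely many quantized continuous affine observables to linear combinations of coherent states. **Proposition.** For holomorphic cylinder functions in $\mathrm{H}^2(\hat L,\nu_L)$, $f|_L$ is the literal restriction; for each $\eta$, the map $f\mapsto f|_L(\cdot-\eta)\alpha^\eta$ is a bijection from $\mathrm{H}^2(\hat L,\nu_L)$ onto $\mathcal{H}^{\hat H}$, and the norm of a wave function does not depend on $\eta$. There is a unique isometric isomorphism $\hat{\mathcal B}:\mathcal{H}^{\tilde S}\to\mathcal{H}^{\hat H}$ that for each base point $\eta\in A$ maps $\hat K^{S,\eta}_\zeta$ to $\hat K^{H}_\zeta$ for all $\zeta\in A$; it does not depend on the base point $\eta$ used to present $\mathcal{H}^{\tilde S}$. Moreover $\mathcal{H}^{\tilde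 S,cp}$ and $\mathcal{H}^{\hat H,cp}$ consist of elements of $\mathcal{H}^{\tilde S}$ and $\mathcal{H}^{\hat H}$ having all the directional derivatives (along $Q$, respectively $L$), they are invariant under all $\check F$, and $\hat{\mathcal B}$ restricts to an isomorphism $\mathcal{H}^{\tilde S,cp}\to\mathcal{H}^{\hat H,cp}$ with $$\hat{\mathcal B}\check F=\check F\hat{\mathcal B}\quad\text{on }\mathcal{H}^{\tilde S,cp}$$ for every continuous affine $F:A\to\mathbb{R}$. -/

import Mathlib

open MeasureTheory ProbabilityTheory
open scoped NNReal ENNReal InnerProductSpace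

noncomputable section

universe u

/-- The cylinder σ-algebra on the algebraic dual of a real vector space. -/
instance algDualMeasurableSpace {V : Type*} [AddCommGroup V] [Module ℝ V] :
    MeasurableSpace (Module.Dual ℝ V) :=
  MeasurableSpace.comap (fun φ v => φ v) MeasurableSpace.pi

/-! Existence and uniqueness of centered Gaussian measures on an algebraic dual. -/

theorem measurable_algDual_eval {V : Type*} [AddCommGroup V] [Module ℝ V] (v : V) :
    Measurable (fun φ : Module.Dual ℝ V => φ v) :=
  (measurable_pi_apply v).comp (comap_measurable (fun (φ : Module.Dual ℝ V) v => φ v))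

theorem continuous_charFun_Lp {Ω : Type*} [MeasurableSpace Ω] (P : Measure Ω)
    [IsProbabilityMeasure P] (t : ℝ) :
    Continuous (fun f : Lp ℝ 2 P => charFun (P.map f) t) := by
  have hform (f : Lp ℝ 2 P) :
      charFun (P.map f) t = ∫ ω, Complex.exp (t * f ω * Complex.I) ∂P := by
    rw [charFun_apply_real, integral_map (Lp.stronglyMeasurable f).aemeasurable (by fun_prop)]
  have hint (f : Lp ℝ 2 P) : Integrable (fun ω => Complex.exp (t * f ω * Complex.I)) P := by
    refine Integrable.of_bound (C := 1) ?_ (.of_forall fun ω => ?_)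
    · have := (Lp.stronglyMeasurable f).measurable
      exact Measurable.aestronglyMeasurable (by fun_prop)
    · rw [← Complex.ofReal_mul, Complex.norm_exp_ofReal_mul_I]
  have hlip : LipschitzWith ‖t‖₊ (fun f : Lp ℝ 2 P => charFun (P.map f) t) := by
    refine LipschitzWith.of_dist_le_mul fun f g => ?_
    rw [dist_eq_norm, dist_eq_norm, hform, hform, ← integral_sub (hint f) (hint g)]
    have hfg : Integrable (fun ω => (f - g : Lp ℝ 2 P) ω) P :=
      (Lp.memLp (f - g)).integrable (by norm_num)
    calc ‖∫ ω, (Complex.exp (t * f ω * Complex.I) - Complex.exp (t * g ω * Complex.I)) ∂P‖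
        ≤ ∫ ω, ‖t‖ * ‖(f - g : Lp ℝ 2 P) ω‖ ∂P := by
          refine norm_integral_le_of_norm_le (hfg.norm.const_mul _) ?_
          filter_upwards [Lp.coeFn_sub f g] with ω hω
          rw [hω, Pi.sub_apply, ← norm_mul, mul_sub]
          have h1 : Complex.exp (t * f ω * Complex.I) - Complex.exp (t * g ω * Complex.I) =
              Complex.exp ((t * g ω : ℝ) * Complex.I) *
                (Complex.exp (Complex.I * ((t * f ω - t * g ω : ℝ))) - 1) := by
            rw [mul_sub, ← Complex.exp_add]
            push_cast
            ring_nf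
          rw [h1, norm_mul, Complex.norm_exp_ofReal_mul_I, one_mul]
          exact Real.norm_exp_I_mul_ofReal_sub_one_le
      _ = ‖t‖ * ∫ ω, ‖(f - g : Lp ℝ 2 P) ω‖ ∂P := integral_const_mul _ _
      _ ≤ ‖t‖ * ‖f - g‖ := by
          gcongr
          rw [integral_norm_eq_lintegral_enorm (Lp.stronglyMeasurable _).aestronglyMeasurable,
            ← eLpNorm_one_eq_lintegral_enorm, Lp.norm_def]
          exact ENNReal.toReal_mono (Lp.eLpNorm_ne_top _)
            (eLpNorm_le_eLpNorm_of_exponent_le (by norm_num)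
              (Lp.stronglyMeasurable _).aestronglyMeasurable)
      _ = _ := by simp
  exact hlip.continuous

theorem exists_linear_gaussian (H : Type u) [NormedAddCommGroup H] [InnerProductSpace ℝ H]
    [CompleteSpace H] :
    ∃ (Ω : Type u) (_ : MeasurableSpace Ω) (P : Measure Ω) (W : H →ₗ[ℝ] Lp ℝ 2 P),
      ∀ h : H, P.map (W h) = gaussianReal 0 (‖h‖₊ ^ 2) := by
  obtain ⟨w, e, -⟩ := exists_hilbertBasis ℝ H
  let P : Measure (w → ℝ) := Measure.infinitePi (fun _ => gaussianReal 0 1)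
  have hlaw (i : w) : P.map (fun ω => ω i) = gaussianReal 0 1 := Measure.infinitePi_map_eval _ i
  have hmem (i : w) : MemLp (fun ω : w → ℝ => ω i) 2 P := by
    have h := memLp_id_gaussianReal (μ := 0) (v := 1) 2
    rw [← hlaw i] at h
    exact h.comp_of_map (measurable_pi_apply i).aemeasurable
  have hind : iIndepFun (fun (i : w) (ω : w → ℝ) => ω i) P :=
    iIndepFun_infinitePi (X := fun _ x => x) (fun _ => measurable_id)
  have hmean (i : w) : ∫ ω, ω i ∂P = 0 := by
    have h := integral_id_gaussianReal (μ := 0) (v := 1)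
    rw [← hlaw i, integral_map (measurable_pi_apply i).aemeasurable (by fun_prop)] at h
    exact h
  have horth : Orthonormal ℝ (fun i => (hmem i).toLp) := by
    classical
    rw [orthonormal_iff_ite]
    intro i j
    have h0 : inner ℝ ((hmem i).toLp) ((hmem j).toLp) = ∫ ω, ω i * ω j ∂P := by
      rw [L2.inner_def]
      refine integral_congr_ae ?_
      filter_upwards [(hmem i).coeFn_toLp, (hmem j).coeFn_toLp] with ω h1 h2
      rw [h1, h2]
      simp [mul_comm]
    rw [h0]
    split_ifs with hij
    · subst hij
      have h := variance_id_gaussianReal (μ := 0) (v := 1)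
      rw [← hlaw i, variance_eq_integral aemeasurable_id,
        integral_map (measurable_pi_apply i).aemeasurable (by fun_prop),
        integral_map (measurable_pi_apply i).aemeasurable (by fun_prop)] at h
      simpa [hmean, sq] using h
    · rw [(hind.indepFun hij).integral_fun_mul_eq_mul_integral
        (measurable_pi_apply i).aestronglyMeasurable (measurable_pi_apply j).aestronglyMeasurable,
        hmean, zero_mul]
  let W : H →ₗᵢ[ℝ] Lp ℝ 2 P := horth.orthogonalFamily.linearIsometry.comp
    e.repr.toLinearIsometry
  have hWe (i : w) : W (e i) = (hmem i).toLp := by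
    classical
    simp [W, OrthogonalFamily.linearIsometry_apply_single, HilbertBasis.repr_self]
  refine ⟨w → ℝ, inferInstance, P, W.toLinearMap, fun h => ?_⟩
  have : IsProbabilityMeasure (P.map (W h)) :=
    Measure.isProbabilityMeasure_map (Lp.stronglyMeasurable _).aemeasurable
  refine Measure.ext_of_charFun ?_
  ext t
  have hclosed : IsClosed {h : H | charFun (P.map (W h)) t =
      charFun (gaussianReal 0 (‖h‖₊ ^ 2)) t} := by
    refine isClosed_eq ((continuous_charFun_Lp P t).comp W.continuous) ?_
    simp only [charFun_gaussianReal]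
    push_cast
    fun_prop
  suffices hs : (Submodule.span ℝ (Set.range e) : Set H) ⊆ {h : H | charFun (P.map (W h)) t =
      charFun (gaussianReal 0 (‖h‖₊ ^ 2)) t} by
    have := hclosed.closure_subset_iff.mpr hs
    have hd := e.dense_span
    rw [← Submodule.topologicalClosure_coe, hd] at this
    exact this (Set.mem_univ h)
  intro x hx
  obtain ⟨c, rfl⟩ := (Finsupp.mem_span_range_iff_exists_finsupp).mp hx
  have hae : (W (c.sum fun i a => a • e i) : (w → ℝ) → ℝ) =ᵐ[P]
      ∑ i ∈ c.support, fun ω : w → ℝ => c i * ω i := by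
    have h1 : W (c.sum fun i a => a • e i) = ∑ i ∈ c.support, c i • (hmem i).toLp := by
      simp [Finsupp.sum, map_sum, hWe]
    rw [h1]
    refine (Lp.coeFn_finsetSum _ _).trans ?_
    have h2 : ∀ᵐ ω ∂P, ∀ i ∈ c.support, (c i • (hmem i).toLp : Lp ℝ 2 P) ω = c i * ω i := by
      rw [Finset.eventually_all]
      intro i _
      filter_upwards [Lp.coeFn_smul (c i) (hmem i).toLp, (hmem i).coeFn_toLp] with ω h3 h4
      simp [h3, h4]
    filter_upwards [h2] with ω hω
    rw [Finset.sum_apply, Finset.sum_apply]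
    exact Finset.sum_congr rfl hω
  show charFun (P.map (W (c.sum fun i a => a • e i))) t = _
  rw [Measure.map_congr hae, iIndepFun.charFun_map_finsetSum_eq_prod
    (fun i _ => ((measurable_pi_apply i).const_mul _).aemeasurable)
    ((hind.comp (fun i x => c i * x) (fun i => measurable_const_mul _)).restrict c.support)]
  have hnorm : ‖c.sum fun i a => a • e i‖ ^ 2 = ∑ i ∈ c.support, c i ^ 2 := by
    rw [Finsupp.sum, ← real_inner_self_eq_norm_sq, e.orthonormal.inner_sum]
    simp [sq]
  have hl (i : w) : P.map (fun ω => c i * ω i) = gaussianReal 0 (.mk (c i ^ 2) (sq_nonneg _)) := by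
    have := gaussianReal_map_const_mul (μ := 0) (v := 1) (c i)
    rw [← hlaw i, Measure.map_map (by fun_prop) (by fun_prop)] at this
    simpa [Function.comp_def] using this
  simp only [Finset.prod_apply, hl, charFun_gaussianReal, ← Complex.exp_sum]
  congr 1
  push_cast
  rw [← Complex.ofReal_pow ‖_‖, hnorm]
  simp [Finset.sum_div, Finset.sum_mul, Finset.sum_neg_distrib]

theorem exists_algDual_gaussian {V : Type*} {H : Type u} [AddCommGroup V] [Module ℝ V]
    [NormedAddCommGroup H] [InnerProductSpace ℝ H] [CompleteSpace H] (r : V →ₗ[ℝ] H) (c : ℝ≥0) :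
    ∃ ν : Measure (Module.Dual ℝ V), ∀ v : V,
      ν.map (fun φ => φ v) = gaussianReal 0 (c * ‖r v‖₊ ^ 2) := by
  obtain ⟨Ω, _, P, W, hW⟩ := exists_linear_gaussian H
  let b := Module.Basis.ofVectorSpace ℝ V
  let s : ℝ := Real.sqrt c
  let Φ : Ω → Module.Dual ℝ V := fun ω => b.constr ℝ (fun k => W (s • r (b k)) ω)
  have hΦ (v : V) (ω) : Φ ω v = (b.repr v).sum fun k a => a * W (s • r (b k)) ω := by
    simp [Φ, Module.Basis.constr_apply]
  have hmeas (v : V) : Measurable (fun ω => Φ ω v) := by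
    simp only [hΦ, Finsupp.sum]
    exact Finset.measurable_fun_sum _ fun k _ =>
      ((Lp.stronglyMeasurable (W (s • r (b k)))).measurable.const_mul _)
  have hΦm : Measurable Φ := by
    rw [measurable_comap_iff]
    exact measurable_pi_lambda _ hmeas
  refine ⟨P.map Φ, fun v => ?_⟩
  rw [Measure.map_map (measurable_algDual_eval v) hΦm]
  have hae : (fun ω => Φ ω v) =ᵐ[P] W (s • r v) := by
    have h1 : W (s • r v) = ∑ k ∈ (b.repr v).support, (b.repr v k) • W (s • r (b k)) := by
      conv_lhs => rw [← b.linearCombination_repr v, Finsupp.linearCombination_apply, Finsupp.sum]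
      simp only [map_sum, map_smul, Finset.smul_sum]
      exact Finset.sum_congr rfl fun k _ => smul_comm _ _ _
    rw [h1]
    refine .trans ?_ (Lp.coeFn_finsetSum _ _).symm
    have h2 : ∀ᵐ ω ∂P, ∀ k ∈ (b.repr v).support,
        ((b.repr v k) • W (s • r (b k)) : Lp ℝ 2 P) ω = (b.repr v k) * W (s • r (b k)) ω := by
      rw [Finset.eventually_all]
      intro k _
      filter_upwards [Lp.coeFn_smul (b.repr v k) (W (s • r (b k)))] with ω hω
      simpa using hω
    filter_upwards [h2] with ω hω
    rw [hΦ, Finsupp.sum, Finset.sum_apply]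
    exact Finset.sum_congr rfl fun k hk => (hω k hk).symm
  have : P.map ((fun φ : Module.Dual ℝ V => φ v) ∘ Φ) = P.map (W (s • r v)) :=
    Measure.map_congr hae
  rw [this, hW]
  congr 1
  ext
  simp [norm_smul, s, mul_pow]

theorem algDual_measure_ext {V : Type*} [AddCommGroup V] [Module ℝ V]
    {ν ν' : Measure (Module.Dual ℝ V)} [IsFiniteMeasure ν] [IsFiniteMeasure ν']
    (h : ∀ v : V, ν.map (fun φ => φ v) = ν'.map (fun φ => φ v)) : ν = ν' := by
  let T : Module.Dual ℝ V → V → ℝ := fun φ v => φ v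
  have hT : Measurable T := comap_measurable _
  have hmap : ν.map T = ν'.map T := by
    refine IsProjectiveLimit.unique (P := fun I : Finset V => (ν.map T).map I.restrict)
      (fun I => rfl) fun I => ?_
    classical
    refine Measure.ext_of_charFunDual ?_
    ext L
    have hL (φ : Module.Dual ℝ V) : L (I.restrict (T φ)) =
        φ (∑ v : I, L (Pi.single v 1) • (v : V)) := by
      rw [map_sum]
      refine (L.toLinearMap.pi_apply_eq_sum_univ (I.restrict (T φ))).trans
        (Finset.sum_congr rfl fun v _ => ?_)
      rw [map_smul, smul_eq_mul, smul_eq_mul, mul_comm]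
      have : (fun k => if v = k then (1 : ℝ) else 0) = Pi.single v 1 := by
        ext k
        simp [Pi.single_apply, eq_comm]
      rw [this]
      rfl
    have key (μ : Measure (Module.Dual ℝ V)) : charFunDual ((μ.map T).map I.restrict) L =
        charFun (μ.map (fun φ => φ (∑ v : I, L (Pi.single v 1) • (v : V)))) 1 := by
      rw [charFunDual_apply, charFun_apply_real, Measure.map_map (by fun_prop) hT,
        integral_map (by fun_prop) (by fun_prop),
        integral_map (measurable_algDual_eval _).aemeasurable (by fun_prop)]
      simp [hL]
    rw [key, key, h]
  ext s hs
  obtain ⟨t, ht, rfl⟩ := hs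
  have := congrArg (fun μ => μ t) hmap
  simpa [Measure.map_apply hT ht] using this

/-- The canonical inclusion of `E` into the algebraic dual of its topological dual. -/
def bidualIncl (E : Type*) [SeminormedAddCommGroup E] [NormedSpace ℝ E] :
    E →ₗ[ℝ] Module.Dual ℝ (StrongDual ℝ E) where
  toFun x := { toFun := fun l => l x, map_add' := fun _ _ => rfl, map_smul' := fun _ _ => rfl }
  map_add' x y := by ext l; exact map_add l x y
  map_smul' a x := by ext l; exact map_smul l a x

/-- `ν` is the centered Gaussian measure on the algebraic dual of the topological dual of `E`
under which each evaluation `φ ↦ φ l` has variance `c * ‖l‖ ^ 2`. Evaluations being linear in `l`,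
this fixes all finite-dimensional marginals. -/
def IsBidualGaussian {E : Type*} [SeminormedAddCommGroup E] [NormedSpace ℝ E] (c : ℝ≥0)
    (ν : Measure (Module.Dual ℝ (StrongDual ℝ E))) : Prop :=
  ∀ l : StrongDual ℝ E, ν.map (fun φ => φ l) = gaussianReal 0 (c * ‖l‖₊ ^ 2)

theorem IsBidualGaussian.isProbabilityMeasure {E : Type*} [SeminormedAddCommGroup E]
    [NormedSpace ℝ E] {c : ℝ≥0} {ν : Measure (Module.Dual ℝ (StrongDual ℝ E))}
    (h : IsBidualGaussian c ν) : IsProbabilityMeasure ν := by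
  have h0 := h 0
  have h1 : ν.map (fun φ => φ 0) Set.univ = 1 := by rw [h0]; exact measure_univ
  rw [Measure.map_apply (measurable_algDual_eval _) MeasurableSet.univ] at h1
  exact ⟨by simpa using h1⟩

theorem IsBidualGaussian.unique {E : Type*} [SeminormedAddCommGroup E]
    [NormedSpace ℝ E] {c : ℝ≥0} {ν ν' : Measure (Module.Dual ℝ (StrongDual ℝ E))}
    (h : IsBidualGaussian c ν) (h' : IsBidualGaussian c ν') : ν = ν' := by
  have := h.isProbabilityMeasure
  have := h'.isProbabilityMeasure
  exact algDual_measure_ext fun l => (h l).trans (h' l).symm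

theorem exists_isBidualGaussian_quotient {L : Type u} [NormedAddCommGroup L]
    [InnerProductSpace ℝ L] [CompleteSpace L] (M : Submodule ℝ L) (c : ℝ≥0) :
    ∃ ν : Measure (Module.Dual ℝ (StrongDual ℝ (L ⧸ M))), IsBidualGaussian c ν := by
  have hnorm (l : StrongDual ℝ (L ⧸ M)) : ‖l.comp M.mkQL‖₊ = ‖l‖₊ := by
    ext
    refine le_antisymm ?_ ?_
    · refine ContinuousLinearMap.opNorm_le_bound _ (norm_nonneg _) fun x => ?_
      exact (l.le_opNorm _).trans
        (mul_le_mul_of_nonneg_left (Submodule.Quotient.norm_mk_le M x) (norm_nonneg l))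
    · refine ContinuousLinearMap.opNorm_le_bound _ (norm_nonneg _) fun x => ?_
      refine le_of_forall_pos_le_add fun ε hε => ?_
      set K := ‖l.comp M.mkQL‖ with hK
      have hK0 : 0 ≤ K := norm_nonneg _
      obtain ⟨m, rfl, hm⟩ := Submodule.Quotient.norm_mk_lt x (show 0 < ε / (K + 1) by positivity)
      have h1 : ‖l (Submodule.Quotient.mk m)‖ ≤ K * ‖m‖ := (l.comp M.mkQL).le_opNorm m
      have h2 : K * (ε / (K + 1)) ≤ ε := by
        rw [mul_div_assoc', div_le_iff₀ (by positivity)]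
        nlinarith
      have h3 := mul_le_mul_of_nonneg_left hm.le hK0
      rw [mul_add] at h3
      exact h1.trans (h3.trans (by gcongr; exact le_rfl))
  let r : StrongDual ℝ (L ⧸ M) →ₗ[ℝ] L :=
    { toFun := fun l => (InnerProductSpace.toDual ℝ L).symm (l.comp M.mkQL)
      map_add' := fun l l' => by rw [ContinuousLinearMap.add_comp, map_add]
      map_smul' := fun a l => by rw [ContinuousLinearMap.smul_comp]; simp }
  obtain ⟨ν, hν⟩ := exists_algDual_gaussian r c
  refine ⟨ν, fun l => ?_⟩
  rw [hν l, ← hnorm l]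
  congr 3
  exact (InnerProductSpace.toDual ℝ L).symm.nnnorm_map _

theorem exists_isBidualGaussian {L : Type u} [NormedAddCommGroup L]
    [InnerProductSpace ℝ L] [CompleteSpace L] (c : ℝ≥0) :
    ∃ ν : Measure (Module.Dual ℝ (StrongDual ℝ L)), IsBidualGaussian c ν := by
  obtain ⟨ν, hν⟩ := exists_algDual_gaussian
    ((InnerProductSpace.toDual ℝ L).symm.toLinearEquiv.toLinearMap) c
  refine ⟨ν, fun l => ?_⟩
  rw [hν l]
  congr 3
  exact (InnerProductSpace.toDual ℝ L).symm.nnnorm_map _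

/-- The symplectic form `ω(ξ, τ) = ½ [ξ, τ] - ½ [τ, ξ]`. -/
def symplecticForm {L : Type*} [NormedAddCommGroup L] [InnerProductSpace ℝ L]
    (br : L →L[ℝ] L →L[ℝ] ℝ) (ξ τ : L) : ℝ :=
  1 / 2 * br ξ τ - 1 / 2 * br τ ξ

/-- `M = {τ : [ξ, τ] = 0 for all ξ}`. -/
def momentumSpace {L : Type*} [NormedAddCommGroup L] [InnerProductSpace ℝ L]
    (br : L →L[ℝ] L →L[ℝ] ℝ) : Submodule ℝ L where
  carrier := {τ | ∀ ξ, br ξ τ = 0}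
  add_mem' ha hb ξ := by rw [map_add, ha ξ, hb ξ, add_zero]
  zero_mem' ξ := map_zero _
  smul_mem' a τ h ξ := by rw [map_smul, h ξ, smul_zero]

/-- `N = {τ : [τ, ξ] = 0 for all ξ}`. -/
def conjugateSpace {L : Type*} [NormedAddCommGroup L] [InnerProductSpace ℝ L]
    (br : L →L[ℝ] L →L[ℝ] ℝ) : Submodule ℝ L :=
  momentumSpace br.flip

/-- The data of an affine field theory with a complex structure. `A` is the affine space of
solutions over `L`; the inner product of the real separable Hilbert space `L` is the form
`g(τ, ξ) = 2 ω(τ, J ξ)`, so the topologies of `L` and `A` are those defined by `g`. -/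
structure AffineFieldTheory (L A : Type*) [NormedAddCommGroup L] [InnerProductSpace ℝ L]
    [CompleteSpace L] [TopologicalSpace.SeparableSpace L] [MetricSpace A]
    [NormedAddTorsor L A] where
  /-- the continuous bilinear form `[·, ·]` -/
  br : L →L[ℝ] L →L[ℝ] ℝ
  /-- the symplectic potential -/
  θ : A → L →ₗ[ℝ] ℝ
  θ_vadd : ∀ (η : A) (ξ τ : L), θ (ξ +ᵥ η) τ = θ η τ + br ξ τ
  /-- `θ` is adapted to the real polarization `M`. -/
  θ_adapted : ∀ (η : A), ∀ τ ∈ momentumSpace br, θ η τ = 0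
  nondegenerate : ∀ ξ, (∀ τ, symplecticForm br ξ τ = 0) → ξ = 0
  sup_eq_top : momentumSpace br ⊔ conjugateSpace br = ⊤
  /-- the complex structure -/
  J : L →ₗ[ℝ] L
  J_J : ∀ ξ, J (J ξ) = -ξ
  J_symplectic : ∀ ξ τ, symplecticForm br (J ξ) (J τ) = symplecticForm br ξ τ
  inner_eq : ∀ τ ξ : L, ⟪τ, ξ⟫_ℝ = 2 * symplecticForm br τ (J ξ)

namespace AffineFieldTheory

variable {L : Type u} {A : Type*} [NormedAddCommGroup L] [InnerProductSpace ℝ L]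
  [CompleteSpace L] [TopologicalSpace.SeparableSpace L] [MetricSpace A] [NormedAddTorsor L A]
  (T : AffineFieldTheory L A)

/-- The Lagrangian subspace `M` of the Schrödinger polarization. -/
abbrev M : Submodule ℝ L := momentumSpace T.br

/-- `Q = L / M` with the quotient norm. -/
abbrev Q : Type u := L ⧸ T.M

/-- The quotient map `q : L → Q`. -/
abbrev q : L →L[ℝ] T.Q := T.M.mkQL

/-- The enlarged configuration space: the algebraic dual of the topological dual of `Q`. -/
abbrev QHat : Type u := Module.Dual ℝ (StrongDual ℝ T.Q)

/-- The inclusion of `Q` into `QHat`. -/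
abbrev inclQ : T.Q →ₗ[ℝ] T.QHat := bidualIncl T.Q

/-- The space of solutions enlarged to the algebraic dual of the topological dual of `L`. -/
abbrev LHat (_ : AffineFieldTheory L A) : Type u := Module.Dual ℝ (StrongDual ℝ L)

/-- The inclusion of `L` into `LHat`. -/
abbrev inclL : L →ₗ[ℝ] T.LHat := bidualIncl L

/-- The symplectic form. -/
abbrev ω (ξ τ : L) : ℝ := symplecticForm T.br ξ τ

theorem isClosed_M : IsClosed (T.M : Set L) := by
  have : (T.M : Set L) = ⋂ ξ, {τ | T.br ξ τ = 0} := by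
    ext τ; simp [momentumSpace]
  rw [this]
  exact isClosed_iInter fun ξ => isClosed_eq (T.br ξ).continuous continuous_const

theorem map_J_le_orthogonal : T.M.map T.J ≤ T.Mᗮ := by
  rintro _ ⟨ξ, hξ, rfl⟩
  intro τ hτ
  rw [T.inner_eq, T.J_J]
  have h1 : T.br τ ξ = 0 := hξ τ
  have h2 : T.br ξ τ = 0 := hτ ξ
  simp [symplecticForm, h1, h2]

theorem orthogonal_le_map_J : T.Mᗮ ≤ T.M.map T.J := by
  intro σ hσ
  have hJ : T.J σ ∈ T.M := by
    intro ξ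
    obtain ⟨m, hm, n, hn, rfl⟩ := Submodule.mem_sup.mp
      (show ξ ∈ momentumSpace T.br ⊔ conjugateSpace T.br by rw [T.sup_eq_top]; trivial)
    have h1 : T.br n (T.J σ) = 0 := hn (T.J σ)
    have h2 : T.br (T.J σ) m = 0 := hm (T.J σ)
    have h3 : ⟪m, σ⟫_ℝ = 0 := hσ m hm
    rw [T.inner_eq, symplecticForm, h2] at h3
    rw [map_add, add_apply, h1]
    linarith
  exact ⟨-T.J σ, T.M.neg_mem hJ, by rw [map_neg, T.J_J, neg_neg]⟩

theorem M_le_ker : T.M ≤ (T.Mᗮ.starProjection : L →L[ℝ] L).ker := by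
  intro τ hτ
  rw [LinearMap.mem_ker]
  exact (Submodule.starProjection_apply_eq_zero_iff _).mpr (Submodule.le_orthogonal_orthogonal _ hτ)

/-- The section `j : Q → L` of `q` with range `J M`; since `J M` is the orthogonal complement of
`M`, it is induced by the orthogonal projection onto `Mᗮ`. -/
def j : T.Q →L[ℝ] L := T.M.liftQL T.Mᗮ.starProjection T.M_le_ker

theorem q_j (φ : T.Q) : T.q (T.j φ) = φ := by
  obtain ⟨ξ, rfl⟩ := T.M.mkQ_surjective φ
  have : T.j (T.M.mkQ ξ) = T.Mᗮ.starProjection ξ := rfl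
  rw [this, T.M.mkQL_apply, ← sub_eq_zero, ← map_sub, Submodule.mkQ_apply,
    Submodule.Quotient.mk_eq_zero]
  have h := Submodule.sub_starProjection_mem_orthogonal (K := T.Mᗮ) ξ
  rw [Submodule.orthogonal_orthogonal_eq_closure, T.isClosed_M.submodule_topologicalClosure_eq] at h
  simpa using T.M.neg_mem h

theorem j_mem (φ : T.Q) : T.j φ ∈ T.M.map T.J := by
  obtain ⟨ξ, rfl⟩ := T.M.mkQ_surjective φ
  exact T.orthogonal_le_map_J (Submodule.starProjection_apply_mem _ ξ)

theorem j_unique (j' : T.Q →ₗ[ℝ] L) (h1 : ∀ φ, T.q (j' φ) = φ)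
    (h2 : ∀ φ, j' φ ∈ T.M.map T.J) : j' = T.j := by
  ext ξ
  set φ : T.Q := T.M.mkQ ξ
  have hM : j' φ - T.j φ ∈ T.M := by
    rw [← Submodule.Quotient.mk_eq_zero, ← Submodule.mkQ_apply, ← T.M.mkQL_apply, map_sub,
      h1, T.q_j, sub_self]
  have hO : j' φ - T.j φ ∈ T.Mᗮ := T.map_J_le_orthogonal (sub_mem (h2 φ) (T.j_mem φ))
  have := hO _ hM
  exact sub_eq_zero.mp (inner_self_eq_zero.mp this)

theorem M_le_ker_br (ξ : L) : T.M ≤ (T.br ξ).ker := fun _ hτ => hτ ξ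

/-- The functional `φ ↦ [ξ, φ]` on `Q`. -/
def brQ (ξ : L) : StrongDual ℝ T.Q := T.M.liftQL (T.br ξ) (T.M_le_ker_br ξ)

/-- The functional `φ ↦ g(j χ, j φ)`, the real part of `φ ↦ Ω(χ, φ)`. -/
def gQ (χ : T.Q) : StrongDual ℝ T.Q := (innerSL ℝ (T.j χ)).comp T.j

/-- `Ω(χ, φ) = g(j χ, j φ) - i [j χ, φ]`. -/
def Ω (χ φ : T.Q) : ℂ := ⟪T.j χ, T.j φ⟫_ℝ - Complex.I * T.brQ (T.j χ) φ

/-- The canonical extension of `φ ↦ Ω(χ, φ)` to `QHat`. -/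
def ΩHat (χ : T.Q) (φ : T.QHat) : ℂ := φ (T.gQ χ) - Complex.I * φ (T.brQ (T.j χ))

theorem ΩHat_incl (χ φ : T.Q) : T.ΩHat χ (T.inclQ φ) = T.Ω χ φ := rfl

/-- The functional `ω(τ, ·)` on `L`. -/
def ωL (τ : L) : StrongDual ℝ L := (1 / 2 : ℝ) • T.br τ - (1 / 2 : ℝ) • T.br.flip τ

/-- The form `{τ, ξ} = g(τ, ξ) + 2 i ω(τ, ξ)`. -/
def herm (τ ξ : L) : ℂ := ⟪τ, ξ⟫_ℝ + 2 * Complex.I * T.ω τ ξ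

/-- The canonical extension of `{τ, ·}` to `LHat`. -/
def hermHat (τ : L) (φ : T.LHat) : ℂ := φ (innerSL ℝ τ) + 2 * Complex.I * φ (T.ωL τ)

theorem hermHat_incl (τ ξ : L) : T.hermHat τ (T.inclL ξ) = T.herm τ ξ := by
  simp [hermHat, herm, bidualIncl, ωL, symplecticForm]

/-- The Gaussian measure on `QHat`, formally `exp(-g(j φ, j φ)) dφ`: variances `½ ‖l‖ ^ 2`. -/
def νQ : Measure T.QHat := (exists_isBidualGaussian_quotient T.M (1 / 2)).choose

theorem νQ_spec : IsBidualGaussian (1 / 2) T.νQ :=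
  (exists_isBidualGaussian_quotient T.M (1 / 2)).choose_spec

/-- The Gaussian measure on `LHat`, formally `exp(-½ g(ξ, ξ)) dξ`: variances `‖l‖ ^ 2`. -/
def νL : Measure T.LHat := (exists_isBidualGaussian (L := L) 1).choose

theorem νL_spec : IsBidualGaussian 1 T.νL := (exists_isBidualGaussian (L := L) 1).choose_spec

/-! The holomorphic representation. -/

/-- Holomorphic cylinder functions on `LHat`: entire functions of finitely many continuous
complex-linear functionals. By Riesz, the latter are the `{τ, ·}`. -/
def IsCylinderHolomorphic (f : T.LHat → ℂ) : Prop :=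
  ∃ (n : ℕ) (τ : Fin n → L) (p : (Fin n → ℂ) → ℂ), Differentiable ℂ p ∧
    ∀ φ, f φ = p (fun i => T.hermHat (τ i) φ)

/-- The Hilbert space `H²(LHat, νL)` of square-integrable holomorphic functions, as the closure in
`L²` of the square-integrable holomorphic cylinder functions. -/
def H2 : Submodule ℂ (Lp ℂ 2 T.νL) :=
  (Submodule.span ℂ {f : Lp ℂ 2 T.νL |
    ∃ p, T.IsCylinderHolomorphic p ∧ f =ᵐ[T.νL] p}).topologicalClosure

/-- The coherent wave functions `exp(½ {τ, ·})` of the linear theory. -/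
def coherentL (τ : L) (φ : T.LHat) : ℂ := Complex.exp (1 / 2 * T.hermHat τ φ)

/-- The restriction to `L` of a square-integrable holomorphic function on `LHat`: since `L` is a
null set in general, it is the pairing with coherent states, which on holomorphic cylinder
functions is evaluation. -/
def restrictL (f : T.H2) (ξ : L) : ℂ :=
  ∫ φ, starRingEnd ℂ (T.coherentL ξ φ) * (f : Lp ℂ 2 T.νL) φ ∂T.νL

/-- The function `α^η` on `A`. -/
def α (η ζ : A) : ℂ :=
  Complex.exp (Complex.I / 2 * T.θ η (ζ -ᵥ η) + Complex.I / 2 * T.θ ζ (ζ -ᵥ η)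
    - 1 / 4 * ⟪ζ -ᵥ η, ζ -ᵥ η⟫_ℝ)

/-- The wave function on `A` of the state presented, relative to the base point `η`, by `f`. -/
def waveH (η : A) (f : T.H2) (ζ : A) : ℂ := T.restrictL f (ζ -ᵥ η) * T.α η ζ

/-- The wave functions on `A` of the states of the holomorphic representation. -/
def HHat : Set (A → ℂ) := {ψ | ∃ (η : A) (f : T.H2), ψ = T.waveH η f}

/-- The wave function of the affine coherent state associated to `η`. -/
def coherentH (η : A) (ζ : A) : ℂ := T.α η ζ

/-- The span of the affine coherent states. -/
def HHat_c : Submodule ℂ (A → ℂ) := Submodule.span ℂ (Set.range T.coherentH)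

/-! The Schrödinger representation. -/

/-- The `η`-reduced Schrödinger wave function of the affine coherent state associated to `ζ`. -/
def coherentS (η ζ : A) (φ : T.QHat) : ℂ :=
  Complex.exp (Complex.I * T.θ ζ (η -ᵥ ζ) - 1 / 2 * T.Ω (T.q (η -ᵥ ζ)) (T.q (η -ᵥ ζ))
    - Complex.I * φ (T.brQ (η -ᵥ ζ)) - T.ΩHat (T.q (η -ᵥ ζ)) φ)

/-- The span of the `η`-reduced wave functions of the affine coherent states. -/
def HS_c (η : A) : Submodule ℂ (T.QHat → ℂ) := Submodule.span ℂ (Set.range (T.coherentS η))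

/-! Quantization of continuous affine observables. -/

/-- The Hamiltonian vector `X_F` of a continuous affine observable. -/
def X (F : A →ᴬ[ℝ] ℝ) : L := T.J ((InnerProductSpace.toDual ℝ L).symm F.contLinear)

theorem X_spec (F : A →ᴬ[ℝ] ℝ) (ξ : L) : 2 * T.ω ξ (T.X F) = F.contLinear ξ := by
  rw [X, ← T.inner_eq, real_inner_comm, InnerProductSpace.toDual_symm_apply]

/-- The quantization of `F` on wave functions on `A`. -/
def quantH (F : A →ᴬ[ℝ] ℝ) (ψ : A → ℂ) (ζ : A) : ℂ :=
  (F ζ - T.θ ζ (T.X F) : ℝ) * ψ ζ - Complex.I * deriv (fun t : ℝ => ψ (t • T.X F +ᵥ ζ)) 0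

/-- The quantization of `F` on `η`-reduced Schrödinger wave functions. -/
def quantS (η : A) (F : A →ᴬ[ℝ] ℝ) (ψ : T.QHat → ℂ) (φ : T.QHat) : ℂ :=
  (F η - φ (T.brQ (T.X F)) + Complex.I * T.ΩHat (T.q (T.X F)) φ) * ψ φ
    - Complex.I * deriv (fun t : ℝ => ψ (φ + t • T.inclQ (T.q (T.X F)))) 0

/-- The span of the functions obtained by applying finitely many quantized continuous affine
observables to elements of the span of the affine coherent states. -/
def HHat_cp : Submodule ℂ (A → ℂ) :=
  Submodule.span ℂ {χ | ∃ (Fs : List (A →ᴬ[ℝ] ℝ)), ∃ ψ ∈ T.HHat_c, χ = Fs.foldr T.quantH ψ}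

/-- The same, for `η`-reduced Schrödinger wave functions. -/
def HS_cp (η : A) : Submodule ℂ (T.QHat → ℂ) :=
  Submodule.span ℂ {χ | ∃ (Fs : List (A →ᴬ[ℝ] ℝ)), ∃ ψ ∈ T.HS_c η, χ = Fs.foldr (T.quantS η) ψ}

/-- The set of states in `L²(QHat, νQ)` represented by elements of `HS_cp η`. -/
def HS_cpL2 (η : A) : Set (Lp ℂ 2 T.νQ) := {f | ∃ ψ ∈ T.HS_cp η, f =ᵐ[T.νQ] ψ}

/-- `B` is the isomorphism of Hilbert spaces from the Schrödinger to the holomorphic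
representation that preserves coherent states. For each base point `η`, the source is presented by
`η`-reduced wave functions and the target by holomorphic functions as in `waveH η`. -/
def IsCoherentIso (B : A → (Lp ℂ 2 T.νQ ≃ₗᵢ[ℂ] T.H2)) : Prop :=
  ∀ η ζ : A, ∃ h : MemLp (T.coherentS η ζ) 2 T.νQ,
    T.waveH η (B η (h.toLp (T.coherentS η ζ))) = T.coherentH ζ

end AffineFieldTheory

end

/-! Both representations are reproducing kernel spaces over `A` with the same kernel. In each
Hilbert space the affine coherent states form a total family indexed by `A`, and both Gram matrices
equal `α`, independently of the base point (`inner_coherentH2At`, `integral_conj_coherentS_mul`). A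
unitary matching the two families therefore exists, and it is unique. It preserves pairings with
coherent states, so the wave function of the image of `f` is the coherent state transform `waveS η
f`, which sends `ζ` to the pairing of the coherent state of `ζ` with `f`. Every statement about the
isomorphism becomes a statement about this integral (`IsCoherentIso.waveH_eq`).

Holomorphic side. The Gaussian measure is invariant under the phase rotations `exp (t J)`, so the
classical mean value property on circles integrates to one for holomorphic cylinder functions.
Combined with the Cameron–Martin theorem it gives the reproducing property. It also shows that on
`H²` the coherent state of `ξ` and the normalized real exponential of `g(ξ, ·)` define the same
functional. Real exponentials are total in `L²`, because Laplace transforms determine finite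
measures; hence restriction to `L` is injective (`eq_zero_of_restrictL_eq_zero`).

Schrödinger side. Coherent states are exponentials of complex evaluations, so their Gram matrix is a
Gaussian Laplace transform at a complex argument. A change of base point is unitary because the
squared modulus of a coherent state is, after the translation, the inverse of a Cameron–Martin
density.

Observables. All functions generated from coherent states are polynomials times exponentials, a
class with finite moments that is stable under differentiation. Gaussian integration by parts moves
the derivative in `quantS` onto the coherent state, and the derivative in `quantH` falls on the
coherent state by differentiation under the integral. The intertwining relation is then a pointwise
identity of integrands (`waveS_quantS`), and the claims about `HHat_cp` follow by transport along
`waveS`. -/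

noncomputable section

/-! ### Gaussian measures on algebraic duals -/

section AlgDual

variable {V : Type*} [AddCommGroup V] [Module ℝ V]

theorem measurable_algDual_iff {Ω : Type*} [MeasurableSpace Ω] {f : Ω → Module.Dual ℝ V} :
    Measurable f ↔ ∀ v, Measurable fun ω => f ω v := by
  rw [measurable_comap_iff]
  exact measurable_pi_iff

theorem measurable_algDual_exp (v : V) :
    Measurable (fun φ : Module.Dual ℝ V => Real.exp (φ v)) :=
  Real.measurable_exp.comp (measurable_algDual_eval v)

/-- Translations of an algebraic dual as measurable equivalences. -/
def algDualShift (h : Module.Dual ℝ V) : Module.Dual ℝ V ≃ᵐ Module.Dual ℝ V where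
  toEquiv := Equiv.addRight h
  measurable_toFun := measurable_algDual_iff.2 fun v =>
    (measurable_algDual_eval v).add_const (h v)
  measurable_invFun := measurable_algDual_iff.2 fun v =>
    (measurable_algDual_eval v).add_const ((-h) v)

@[simp]
theorem algDualShift_apply (h φ : Module.Dual ℝ V) : algDualShift h φ = φ + h := rfl

/-- Finite measures on an algebraic dual with equal finite Laplace transforms coincide. -/
theorem algDual_measure_ext_of_integral_exp {ν ν' : Measure (Module.Dual ℝ V)}
    [IsFiniteMeasure ν] [IsFiniteMeasure ν']
    (hν : ∀ v, Integrable (fun φ => Real.exp (φ v)) ν)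
    (h : ∀ v, ∫ φ, Real.exp (φ v) ∂ν = ∫ φ, Real.exp (φ v) ∂ν') : ν = ν' := by
  refine algDual_measure_ext fun v => ?_
  have hset {μ : Measure (Module.Dual ℝ V)} (hμ : ∀ v, Integrable (fun φ => Real.exp (φ v)) μ) :
      integrableExpSet (fun φ : Module.Dual ℝ V => φ v) μ = Set.univ :=
    Set.eq_univ_of_forall fun t => by simpa [integrableExpSet] using hμ (t • v)
  refine Measure.ext_of_complexMGF_eq (measurable_algDual_eval v).aemeasurable
    (measurable_algDual_eval v).aemeasurable ?_
  have hmgf : mgf (fun φ : Module.Dual ℝ V => φ v) ν = mgf (fun φ => φ v) ν' := by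
    ext t
    simpa [mgf] using h (t • v)
  -- The total masses agree by the hypothesis at `v = 0`. The Laplace transform is finite on the
  -- whole line, so analytic continuation identifies the two complex transforms on all of `ℂ`, in
  -- particular on the imaginary axis.
  have h0 : ν = 0 ↔ ν' = 0 := by
    have h1 : ν.real Set.univ = ν'.real Set.univ := by simpa using h 0
    rw [← Measure.measure_univ_eq_zero, ← Measure.measure_univ_eq_zero,
      ← measureReal_eq_zero_iff, ← measureReal_eq_zero_iff, h1]
  ext z
  exact eqOn_complexMGF_of_mgf' hmgf h0 (by simp [hset hν])

end AlgDual

/-- `ν` is a centered Gaussian measure on the algebraic dual of `V` with covariance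
`c * ⟪r v, r w⟫`. -/
def IsAlgDualGaussian {V H : Type*} [AddCommGroup V] [Module ℝ V] [NormedAddCommGroup H]
    [InnerProductSpace ℝ H] (r : V →ₗ[ℝ] H) (c : ℝ≥0) (ν : Measure (Module.Dual ℝ V)) : Prop :=
  ∀ v : V, ν.map (fun φ => φ v) = gaussianReal 0 (c * ‖r v‖₊ ^ 2)

namespace IsAlgDualGaussian

variable {V H : Type*} [AddCommGroup V] [Module ℝ V] [NormedAddCommGroup H]
    [InnerProductSpace ℝ H] {r : V →ₗ[ℝ] H} {c : ℝ≥0} {ν : Measure (Module.Dual ℝ V)}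

theorem isProbabilityMeasure (hν : IsAlgDualGaussian r c ν) : IsProbabilityMeasure ν := by
  have h1 : ν.map (fun φ => φ 0) Set.univ = 1 := by rw [hν 0]; exact measure_univ
  rw [Measure.map_apply (measurable_algDual_eval _) MeasurableSet.univ] at h1
  exact ⟨by simpa using h1⟩

theorem memLp_eval (hν : IsAlgDualGaussian r c ν) (v : V) {p : ℝ≥0∞} (hp : p ≠ ∞) :
    MemLp (fun φ => φ v) p ν := by
  have h := memLp_id_gaussianReal' (μ := 0) (v := c * ‖r v‖₊ ^ 2) p hp
  rw [← hν v] at h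
  exact h.comp_of_map (measurable_algDual_eval v).aemeasurable

theorem integrable_exp (hν : IsAlgDualGaussian r c ν) (v : V) :
    Integrable (fun φ => Real.exp (φ v)) ν := by
  have h := integrable_exp_mul_gaussianReal (μ := 0) (v := c * ‖r v‖₊ ^ 2) 1
  rw [← hν v, integrable_map_measure (by fun_prop) (measurable_algDual_eval v).aemeasurable] at h
  simpa [Function.comp_def] using h

theorem integral_exp (hν : IsAlgDualGaussian r c ν) (v : V) :
    ∫ φ, Real.exp (φ v) ∂ν = Real.exp (c * ‖r v‖ ^ 2 / 2) := by
  have := mgf_gaussianReal (hν v) 1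
  simpa [mgf] using this

/-- A power of an exponential of an evaluation is the exponential of a multiple of that evaluation,
hence integrable. -/
theorem memLp_exp (hν : IsAlgDualGaussian r c ν) (v : V) {p : ℝ≥0∞} (hp : p ≠ ∞) :
    MemLp (fun φ => Real.exp (φ v)) p ν := by
  rcases eq_or_ne p 0 with rfl | h0
  · simpa using (measurable_algDual_exp v).aestronglyMeasurable
  rw [← integrable_norm_rpow_iff (measurable_algDual_exp v).aestronglyMeasurable h0 hp]
  refine (hν.integrable_exp (p.toReal • v)).congr (.of_forall fun φ => ?_)
  simp [← Real.exp_mul, mul_comm]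

/-- The Cameron–Martin theorem: translation by the covariance of `v₀` is an exponential tilt. -/
theorem map_shift (hν : IsAlgDualGaussian r c ν) {h : Module.Dual ℝ V} {v₀ : V}
    (hh : ∀ v, h v = c * ⟪r v₀, r v⟫_ℝ) :
    ν.map (algDualShift h) = ν.tilted (fun φ => φ v₀) := by
  have := hν.isProbabilityMeasure
  have h1 := isProbabilityMeasure_tilted (hν.integrable_exp v₀)
  have h2 : IsProbabilityMeasure (ν.map (algDualShift h)) :=
    Measure.isProbabilityMeasure_map (algDualShift h).measurable.aemeasurable
  -- Completing the square shows that both Laplace transforms at `v` equal the exponential of `c *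
  -- ‖r v‖ ^ 2 / 2 + c * ⟪r v₀, r v⟫`.
  refine algDual_measure_ext_of_integral_exp (fun v => ?_) (fun v => ?_)
  · rw [integrable_map_equiv]
    simpa [Function.comp_def, Real.exp_add] using (hν.integrable_exp v).mul_const _
  · rw [integral_map_equiv, integral_exp_tilted]
    have e1 : ∫ φ, Real.exp (((fun φ : Module.Dual ℝ V => φ v₀) + fun φ : Module.Dual ℝ V => φ v) φ) ∂ν =
        Real.exp (c * ‖r (v₀ + v)‖ ^ 2 / 2) := by
      rw [← hν.integral_exp]
      simp
    rw [e1, hν.integral_exp]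
    simp only [algDualShift_apply, LinearMap.add_apply, Real.exp_add, integral_mul_const,
      hν.integral_exp, hh]
    rw [← Real.exp_add, ← Real.exp_sub, map_add, norm_add_sq_real]
    ring_nf

/-- Cameron–Martin with the normalized density written out. Translation is a measurable equivalence,
so `G` need not be measurable or integrable. -/
theorem integral_comp_shift (hν : IsAlgDualGaussian r c ν) {h : Module.Dual ℝ V} {v₀ : V}
    (hh : ∀ v, h v = c * ⟪r v₀, r v⟫_ℝ) (G : Module.Dual ℝ V → ℂ) :
    ∫ φ, G (φ + h) ∂ν = ∫ φ, (Real.exp (φ v₀ - c * ‖r v₀‖ ^ 2 / 2) : ℂ) * G φ ∂ν := by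
  have h1 := integral_map_equiv (μ := ν) (algDualShift h) G
  rw [hν.map_shift hh, integral_tilted] at h1
  simp only [algDualShift_apply] at h1
  rw [← h1]
  simp only [hν.integral_exp, Complex.real_smul, ← Real.exp_sub]

theorem integrable_comp_shift (hν : IsAlgDualGaussian r c ν) {h : Module.Dual ℝ V} {v₀ : V}
    (hh : ∀ v, h v = c * ⟪r v₀, r v⟫_ℝ) (G : Module.Dual ℝ V → ℂ) :
    Integrable (fun φ => G (φ + h)) ν ↔
      Integrable (fun φ => (Real.exp (φ v₀) : ℂ) * G φ) ν := by
  have := hν.isProbabilityMeasure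
  have h1 := integrable_map_equiv (μ := ν) (algDualShift h) G
  rw [hν.map_shift hh, integrable_tilted_iff (hν.integrable_exp v₀)] at h1
  exact h1.symm

/-- Real exponentials of evaluations are total in `L²`. -/
theorem eq_zero_of_integral_exp_eq_zero (hν : IsAlgDualGaussian r c ν) {f : Module.Dual ℝ V → ℂ}
    (hf : MemLp f 2 ν) (h : ∀ v, ∫ φ, (Real.exp (φ v) : ℂ) * f φ ∂ν = 0) : f =ᵐ[ν] 0 := by
  have := hν.isProbabilityMeasure
  -- Real case: the positive and negative parts of `g`, used as densities, give finite measures with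
  -- equal Laplace transforms. The measures coincide, hence so do the two parts.
  have key (g : Module.Dual ℝ V → ℝ) (hg : MemLp g 2 ν)
      (h0 : ∀ v, ∫ φ, Real.exp (φ v) * g φ ∂ν = 0) : g =ᵐ[ν] 0 := by
    have hgi : Integrable g ν := hg.integrable (by norm_num)
    have hgm (v : V) : Integrable (fun φ => Real.exp (φ v) * g φ) ν :=
      (hν.memLp_exp v (by norm_num : (2 : ℝ≥0∞) ≠ ∞)).integrable_mul hg
    let gp : Module.Dual ℝ V → ℝ := fun φ => max (g φ) 0
    let gm : Module.Dual ℝ V → ℝ := fun φ => max (-g φ) 0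
    have hp : Integrable gp ν := hgi.pos_part
    have hm : Integrable gm ν := hgi.neg_part
    have hexp (v : V) (φ : Module.Dual ℝ V) : 0 ≤ Real.exp (φ v) := (Real.exp_pos _).le
    have hpe (v : V) : Integrable (fun φ => Real.exp (φ v) * gp φ) ν := by
      refine (hgm v).pos_part.congr (.of_forall fun φ => ?_)
      simp only [gp]
      rw [mul_max_of_nonneg _ _ (hexp v φ), mul_zero]
    have hme (v : V) : Integrable (fun φ => Real.exp (φ v) * gm φ) ν := by
      refine (hgm v).neg_part.congr (.of_forall fun φ => ?_)
      simp only [gm]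
      rw [mul_max_of_nonneg _ _ (hexp v φ), mul_zero, mul_neg]
    have hpn (φ) : (ENNReal.ofReal (gp φ)).toReal = gp φ :=
      ENNReal.toReal_ofReal (le_max_right _ _)
    have hmn (φ) : (ENNReal.ofReal (gm φ)).toReal = gm φ :=
      ENNReal.toReal_ofReal (le_max_right _ _)
    have : IsFiniteMeasure (ν.withDensity fun φ => ENNReal.ofReal (gp φ)) :=
      isFiniteMeasure_withDensity_ofReal hp.2
    have : IsFiniteMeasure (ν.withDensity fun φ => ENNReal.ofReal (gm φ)) :=
      isFiniteMeasure_withDensity_ofReal hm.2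
    have hpI (G : Module.Dual ℝ V → ℝ) :
        ∫ φ, G φ ∂(ν.withDensity fun φ => ENNReal.ofReal (gp φ)) = ∫ φ, G φ * gp φ ∂ν := by
      rw [integral_withDensity_eq_integral_toReal_smul₀ hp.1.aemeasurable.ennreal_ofReal (by simp)]
      exact integral_congr_ae (.of_forall fun φ => by simp only [hpn, smul_eq_mul, mul_comm])
    have hmI (G : Module.Dual ℝ V → ℝ) :
        ∫ φ, G φ ∂(ν.withDensity fun φ => ENNReal.ofReal (gm φ)) = ∫ φ, G φ * gm φ ∂ν := by
      rw [integral_withDensity_eq_integral_toReal_smul₀ hm.1.aemeasurable.ennreal_ofReal (by simp)]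
      exact integral_congr_ae (.of_forall fun φ => by simp only [hmn, smul_eq_mul, mul_comm])
    have heq := algDual_measure_ext_of_integral_exp
      (ν := ν.withDensity fun φ => ENNReal.ofReal (gp φ))
      (ν' := ν.withDensity fun φ => ENNReal.ofReal (gm φ)) (fun v => ?_) fun v => ?_
    · have h1 := (withDensity_eq_iff hp.1.aemeasurable.ennreal_ofReal
        hm.1.aemeasurable.ennreal_ofReal (hp.lintegral_lt_top).ne).1 heq
      filter_upwards [h1] with φ h2
      rw [ENNReal.ofReal_eq_ofReal_iff (le_max_right _ _) (le_max_right _ _)] at h2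
      change max (g φ) 0 = max (-g φ) 0 at h2
      rcases le_total (g φ) 0 with h3 | h3
      · rw [max_eq_right h3, max_eq_left (by linarith)] at h2
        simp; linarith
      · rw [max_eq_left h3, max_eq_right (by linarith)] at h2
        simp; linarith
    · rw [integrable_withDensity_iff_integrable_smul₀' hp.1.aemeasurable.ennreal_ofReal (by simp)]
      refine (hpe v).congr (.of_forall fun φ => by simp only [hpn, smul_eq_mul, mul_comm])
    · rw [hpI, hmI, ← sub_eq_zero, ← integral_sub (hpe v) (hme v), ← h0 v]
      refine integral_congr_ae (.of_forall fun φ => ?_)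
      simp only [gp, gm]
      rw [← mul_sub]
      congr 1
      rcases le_total (g φ) 0 with h3 | h3
      · rw [max_eq_right h3, max_eq_left (by linarith)]; ring
      · rw [max_eq_left h3, max_eq_right (by linarith)]; ring
  have hint (v : V) : Integrable (fun φ => (Real.exp (φ v) : ℂ) * f φ) ν :=
    (hν.memLp_exp v (by norm_num : (2 : ℝ≥0∞) ≠ ∞)).ofReal.integrable_mul hf
  have hre := key (fun φ => (f φ).re) hf.re fun v => by
    have h1 := integral_re (𝕜 := ℂ) (hint v)
    rw [h v] at h1
    simpa only [RCLike.re_to_complex, Complex.re_ofReal_mul, Complex.zero_re] using h1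
  have him := key (fun φ => (f φ).im) hf.im fun v => by
    have h1 := integral_im (𝕜 := ℂ) (hint v)
    rw [h v] at h1
    simpa only [RCLike.im_to_complex, Complex.im_ofReal_mul, Complex.zero_im] using h1
  filter_upwards [hre, him] with φ h1 h2
  exact Complex.ext h1 h2

end IsAlgDualGaussian

/-- A function with finite moments of all orders. -/
def HasAllMoments {Ω : Type*} [MeasurableSpace Ω] (f : Ω → ℂ) (ν : Measure Ω) : Prop :=
  ∀ p : ℝ≥0∞, p ≠ ∞ → MemLp f p ν

namespace HasAllMoments

variable {Ω : Type*} [MeasurableSpace Ω] {f g : Ω → ℂ} {ν : Measure Ω}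

theorem add (hf : HasAllMoments f ν) (hg : HasAllMoments g ν) :
    HasAllMoments (fun φ => f φ + g φ) ν := fun p hp => (hf p hp).add (hg p hp)

theorem const_mul (hf : HasAllMoments f ν) (z : ℂ) : HasAllMoments (fun φ => z * f φ) ν :=
  fun p hp => (hf p hp).const_mul z

/-- Hölder with exponents `2p, 2p, p`. This closure under products is the reason for asking for all
moments and not only the second. -/
theorem mul (hf : HasAllMoments f ν) (hg : HasAllMoments g ν) :
    HasAllMoments (fun φ => f φ * g φ) ν := fun p hp => by
  have h2 : 2 * p ≠ ∞ := ENNReal.mul_ne_top (by norm_num) hp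
  have : ENNReal.HolderTriple (2 * p) (2 * p) p := ⟨by
    rw [ENNReal.mul_inv (Or.inl (by norm_num)) (Or.inl (by norm_num)), ← add_mul,
      ENNReal.inv_two_add_inv_two, one_mul]⟩
  exact (hg _ h2).mul (hf _ h2)

theorem memLp_two (hf : HasAllMoments f ν) : MemLp f 2 ν := hf 2 (by norm_num)

theorem integrable (hf : HasAllMoments f ν) : Integrable f ν :=
  memLp_one_iff_integrable.1 (hf 1 (by norm_num))

theorem congr (hf : HasAllMoments f ν) (h : ∀ φ, f φ = g φ) : HasAllMoments g ν := by
  rwa [← funext h]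

end HasAllMoments

/-! ### Complex-valued evaluations -/

section CEval

variable {V : Type*} [AddCommGroup V] [Module ℝ V]

/-- The complex-valued evaluation `φ ↦ φ a + i φ b`. -/
def cEval (a b : V) (φ : Module.Dual ℝ V) : ℂ := φ a + Complex.I * φ b

theorem cEval_add (a b a' b' : V) (φ : Module.Dual ℝ V) :
    cEval (a + a') (b + b') φ = cEval a b φ + cEval a' b' φ := by
  simp only [cEval, map_add, Complex.ofReal_add]; ring

theorem cEval_smul (s : ℝ) (a b : V) (φ : Module.Dual ℝ V) :
    cEval (s • a) (s • b) φ = s * cEval a b φ := by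
  simp only [cEval, map_smul, smul_eq_mul, Complex.ofReal_mul]; ring

theorem cEval_add_dual (a b : V) (φ h : Module.Dual ℝ V) :
    cEval a b (φ + h) = cEval a b φ + cEval a b h := by
  simp only [cEval, LinearMap.add_apply, Complex.ofReal_add]; ring

theorem cEval_smul_dual (a b : V) (s : ℝ) (h : Module.Dual ℝ V) :
    cEval a b (s • h) = s * cEval a b h := by
  simp only [cEval, LinearMap.smul_apply, smul_eq_mul, Complex.ofReal_mul]; ring

theorem conj_cEval (a b : V) (φ : Module.Dual ℝ V) :
    starRingEnd ℂ (cEval a b φ) = cEval a (-b) φ := by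
  simp [cEval]

theorem cEval_re (a b : V) (φ : Module.Dual ℝ V) : (cEval a b φ).re = φ a := by
  simp [cEval]

theorem norm_exp_cEval (a b : V) (φ : Module.Dual ℝ V) :
    ‖Complex.exp (cEval a b φ)‖ = Real.exp (φ a) := by
  rw [Complex.norm_exp, cEval_re]

theorem measurable_cEval (a b : V) : Measurable (cEval a b) :=
  (Complex.measurable_ofReal.comp (measurable_algDual_eval a)).add
    ((Complex.measurable_ofReal.comp (measurable_algDual_eval b)).const_mul _)

end CEval

/-! ### Complex exponentials under a Gaussian measure -/

namespace IsAlgDualGaussian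

variable {V H : Type*} [AddCommGroup V] [Module ℝ V] [NormedAddCommGroup H]
    [InnerProductSpace ℝ H] {r : V →ₗ[ℝ] H} {c : ℝ≥0} {ν : Measure (Module.Dual ℝ V)}

theorem hasAllMoments_eval (hν : IsAlgDualGaussian r c ν) (v : V) :
    HasAllMoments (fun φ => (φ v : ℂ)) ν := fun _ hp => (hν.memLp_eval v hp).ofReal

theorem hasAllMoments_cEval (hν : IsAlgDualGaussian r c ν) (a b : V) :
    HasAllMoments (cEval a b) ν :=
  (hν.hasAllMoments_eval a).add ((hν.hasAllMoments_eval b).const_mul _)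

theorem hasAllMoments_exp (hν : IsAlgDualGaussian r c ν) (a b : V) :
    HasAllMoments (fun φ => Complex.exp (cEval a b φ)) ν := fun p hp => by
  refine (hν.memLp_exp a hp).of_le (Complex.measurable_exp.comp
    (measurable_cEval a b)).aestronglyMeasurable (.of_forall fun φ => ?_)
  rw [norm_exp_cEval, Real.norm_of_nonneg (Real.exp_pos _).le]

/-- The Laplace transform at complex arguments. -/
theorem integral_exp_cEval (hν : IsAlgDualGaussian r c ν) (a b : V) :
    ∫ φ, Complex.exp (cEval a b φ) ∂ν =
      Complex.exp (c / 2 * (‖r a‖ ^ 2 - ‖r b‖ ^ 2) + Complex.I * (c * ⟪r a, r b⟫_ℝ)) := by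
  let h : Module.Dual ℝ V := (c : ℝ) • (innerₗ H (r a)).comp r
  have hh (v : V) : h v = c * ⟪r a, r v⟫_ℝ := by simp [h]
  -- The weight `exp (φ a)` is a Cameron–Martin translation, which only multiplies `exp (i φ b)` by
  -- a phase. What is left is a one-dimensional characteristic function.
  have h1 := hν.integral_comp_shift hh (fun φ => Complex.exp (Complex.I * φ b))
  have h2 := complexMGF_gaussianReal (hν b) Complex.I
  rw [complexMGF] at h2
  simp only [LinearMap.add_apply, Complex.ofReal_add, mul_add, Complex.exp_add, hh,
    integral_mul_const, h2] at h1
  have h3 : ∫ φ, (Real.exp (φ a - c * ‖r a‖ ^ 2 / 2) : ℂ) * Complex.exp (Complex.I * φ b) ∂ν =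
      Complex.exp (-(c * ‖r a‖ ^ 2 / 2)) * ∫ φ, Complex.exp (cEval a b φ) ∂ν := by
    rw [← integral_const_mul]
    refine integral_congr_ae (.of_forall fun φ => ?_)
    simp only [cEval]
    push_cast
    rw [← Complex.exp_add, ← Complex.exp_add]
    ring_nf
  rw [h3, ← Complex.exp_add] at h1
  rw [← mul_right_inj' (Complex.exp_ne_zero (-(c * ‖r a‖ ^ 2 / 2))), ← h1, ← Complex.exp_add,
    ← Complex.exp_add]
  congr 1
  push_cast
  rw [Complex.I_sq]
  ring

/-- Differentiation under the integral sign along an exponential family. -/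
theorem hasDerivAt_integral_exp (hν : IsAlgDualGaussian r c ν) {f : Module.Dual ℝ V → ℂ}
    (hf : MemLp f 2 ν) (a b a' b' : V) :
    HasDerivAt (fun s : ℝ => ∫ φ, Complex.exp (cEval a b φ + s * cEval a' b' φ) * f φ ∂ν)
      (∫ φ, cEval a' b' φ * (Complex.exp (cEval a b φ) * f φ) ∂ν) 0 := by
  have hmeas (s : ℝ) : HasAllMoments
      (fun φ => Complex.exp (cEval a b φ + s * cEval a' b' φ)) ν :=
    (hν.hasAllMoments_exp (a + s • a') (b + s • b')).congr fun φ => by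
      rw [cEval_add, cEval_smul]
  -- For `|s| < 1` one has `exp (s x) ≤ exp x + exp (-x)`, which dominates the derivative uniformly
  -- in `s`.
  have hbound : Integrable (fun φ => ‖cEval a' b' φ‖ * (Real.exp (φ (a + a')) +
      Real.exp (φ (a - a'))) * ‖f φ‖) ν := by
    have h1 : MemLp (fun φ => ‖cEval a' b' φ‖ * (Real.exp (φ (a + a')) +
      Real.exp (φ (a - a')))) 2 ν := by
      have h2 := ((hν.hasAllMoments_cEval a' b').mul
        ((hν.hasAllMoments_exp (a + a') 0).add (hν.hasAllMoments_exp (a - a') 0))).memLp_two.norm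
      refine (memLp_congr_ae (.of_forall fun φ => ?_)).1 h2
      simp only [cEval, norm_mul, map_zero, Complex.ofReal_zero, mul_zero, add_zero]
      rw [← Complex.ofReal_exp, ← Complex.ofReal_exp, ← Complex.ofReal_add,
        Complex.norm_of_nonneg (by positivity)]
    exact h1.integrable_mul hf.norm
  have key := hasDerivAt_integral_of_dominated_loc_of_deriv_le (μ := ν) (x₀ := (0 : ℝ))
    (F := fun s φ => Complex.exp (cEval a b φ + (s : ℝ) * cEval a' b' φ) * f φ)
    (F' := fun s φ => cEval a' b' φ *
      (Complex.exp (cEval a b φ + (s : ℝ) * cEval a' b' φ) * f φ))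
    (Metric.ball_mem_nhds (0 : ℝ) one_pos)
    (.of_forall fun s => (hmeas s).memLp_two.1.mul hf.1)
    ((hmeas 0).memLp_two.integrable_mul hf)
    ((measurable_cEval a' b').aestronglyMeasurable.mul ((hmeas 0).memLp_two.1.mul hf.1))
    (.of_forall fun φ s hs => ?_) hbound (.of_forall fun φ s hs => ?_)
  · simpa using key.2
  · rw [norm_mul, norm_mul, ← mul_assoc]
    gcongr
    rw [Complex.norm_exp, Complex.add_re, Complex.re_ofReal_mul, cEval_re, cEval_re, map_add,
      map_sub]
    have hs' := abs_lt.1 (by simpa using hs : |s| < 1)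
    rcases le_total 0 (φ a') with h0 | h0
    · exact (Real.exp_le_exp.2 (by nlinarith)).trans (le_add_of_nonneg_right (Real.exp_pos _).le)
    · exact (Real.exp_le_exp.2 (by nlinarith)).trans (le_add_of_nonneg_left (Real.exp_pos _).le)
  · have h1 : HasDerivAt (fun s : ℝ => cEval a b φ + (s : ℂ) * cEval a' b' φ) (cEval a' b' φ) s := by
      simpa using ((Complex.ofRealCLM.hasDerivAt (x := s)).mul_const (cEval a' b' φ)).const_add
        (cEval a b φ)
    exact (h1.cexp.mul_const (f φ)).congr_deriv (by ring)

end IsAlgDualGaussian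

/-! ### Polynomial times exponential functions and integration by parts -/

/-- Polynomial times exponential functions on an algebraic dual. -/
inductive IsPolyExp {V : Type*} [AddCommGroup V] [Module ℝ V] : (Module.Dual ℝ V → ℂ) → Prop
  | exp (a b : V) : IsPolyExp fun φ => Complex.exp (cEval a b φ)
  | add {f g : Module.Dual ℝ V → ℂ} : IsPolyExp f → IsPolyExp g → IsPolyExp fun φ => f φ + g φ
  | const_mul (z : ℂ) {f : Module.Dual ℝ V → ℂ} : IsPolyExp f → IsPolyExp fun φ => z * f φ
  | eval_mul (v : V) {f : Module.Dual ℝ V → ℂ} : IsPolyExp f → IsPolyExp fun φ => φ v * f φ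

namespace IsPolyExp

variable {V H : Type*} [AddCommGroup V] [Module ℝ V] [NormedAddCommGroup H]
    [InnerProductSpace ℝ H] {r : V →ₗ[ℝ] H} {c : ℝ≥0} {ν : Measure (Module.Dual ℝ V)}
    {f g : Module.Dual ℝ V → ℂ}

theorem zero : IsPolyExp (fun _ : Module.Dual ℝ V => (0 : ℂ)) := by
  simpa using (IsPolyExp.exp (0 : V) 0).const_mul 0

theorem cEval_mul (a b : V) (hf : IsPolyExp f) : IsPolyExp fun φ => cEval a b φ * f φ := by
  simp only [cEval, add_mul, mul_assoc]
  exact (hf.eval_mul a).add ((hf.eval_mul b).const_mul _)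

theorem hasAllMoments (hν : IsAlgDualGaussian r c ν) (hf : IsPolyExp f) : HasAllMoments f ν := by
  induction hf with
  | exp a b => exact hν.hasAllMoments_exp a b
  | add _ _ h1 h2 => exact h1.add h2
  | const_mul z _ h => exact h.const_mul z
  | eval_mul v _ h => exact (hν.hasAllMoments_eval v).mul h

/-- Directional derivatives of polynomial times exponential functions, and Gaussian integration
by parts against exponentials in the direction of the covariance of `v₀`. -/
theorem exists_hasDerivAt (hν : IsAlgDualGaussian r c ν) (hf : IsPolyExp f)
    (h : Module.Dual ℝ V) :
    ∃ f' : Module.Dual ℝ V → ℂ, IsPolyExp f' ∧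
      (∀ φ, HasDerivAt (fun t : ℝ => f (φ + t • h)) (f' φ) 0) ∧
      ∀ v₀ : V, (∀ v, h v = c * ⟪r v₀, r v⟫_ℝ) → ∀ a b : V,
        ∫ φ, Complex.exp (cEval a b φ) * (f' φ + cEval a b h * f φ) ∂ν =
          ∫ φ, Complex.exp (cEval a b φ) * (φ v₀ * f φ) ∂ν := by
  -- The derivative and the integration by parts are proved together because they share `f'`. The
  -- identity is kept for all `a` and `b`, since the `eval_mul` case varies `a`.
  induction hf with
  | exp a₀ b₀ =>
    refine ⟨fun φ => cEval a₀ b₀ h * Complex.exp (cEval a₀ b₀ φ), (IsPolyExp.exp _ _).const_mul _,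
      fun φ => ?_, fun v₀ hh a b => ?_⟩
    · have h1 : HasDerivAt (fun s : ℝ => cEval a₀ b₀ (φ + s • h)) (cEval a₀ b₀ h) 0 := by
        simp only [cEval_add_dual, cEval_smul_dual]
        simpa using ((Complex.ofRealCLM.hasDerivAt (x := 0)).mul_const (cEval a₀ b₀ h)).const_add
          (cEval a₀ b₀ φ)
      convert h1.cexp using 1
      simp [mul_comm]
    · have := hν.isProbabilityMeasure
      -- The Laplace transform at `a + a₀ + s • v₀` is differentiated twice over: under the
      -- integral, which brings down `φ v₀`, and in closed form, which brings down the covariance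
      -- `h`.
      have h1 := hν.hasDerivAt_integral_exp (memLp_const (1 : ℂ)) (a + a₀) (b + b₀) v₀ 0
      have e (s : ℝ) (φ : Module.Dual ℝ V) : cEval (a + a₀) (b + b₀) φ + s * cEval v₀ 0 φ =
          cEval (a + a₀ + s • v₀) (b + b₀) φ := by
        rw [← cEval_smul, ← cEval_add, smul_zero, add_zero]
      simp only [mul_one, e, hν.integral_exp_cEval] at h1
      have h2 : HasDerivAt (fun s : ℝ => Complex.exp (c / 2 * (‖r (a + a₀ + s • v₀)‖ ^ 2 -
          ‖r (b + b₀)‖ ^ 2) + Complex.I * (c * ⟪r (a + a₀ + s • v₀), r (b + b₀)⟫_ℝ)))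
          (cEval (a + a₀) (b + b₀) h * Complex.exp (c / 2 * (‖r (a + a₀)‖ ^ 2 -
          ‖r (b + b₀)‖ ^ 2) + Complex.I * (c * ⟪r (a + a₀), r (b + b₀)⟫_ℝ))) 0 := by
        have h3 : HasDerivAt (fun s : ℝ => (c / 2 * (‖r (a + a₀ + s • v₀)‖ ^ 2 -
            ‖r (b + b₀)‖ ^ 2) + Complex.I * (c * ⟪r (a + a₀ + s • v₀), r (b + b₀)⟫_ℝ) : ℂ))
            (cEval (a + a₀) (b + b₀) h) 0 := by
          have h4 : HasDerivAt (fun s : ℝ => (‖r (a + a₀)‖ ^ 2 + 2 * (s * ⟪r (a + a₀), r v₀⟫_ℝ)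
              + (s * ‖r v₀‖) ^ 2 : ℝ)) (2 * ⟪r (a + a₀), r v₀⟫_ℝ) 0 := by
            exact ((((hasDerivAt_id (0 : ℝ)).mul_const ⟪r (a + a₀), r v₀⟫_ℝ).const_mul
              2).const_add (‖r (a + a₀)‖ ^ 2) |>.add
              (((hasDerivAt_id (0 : ℝ)).mul_const ‖r v₀‖).pow 2)).congr_deriv (by simp)
          have h5 : HasDerivAt (fun s : ℝ => (⟪r (a + a₀), r (b + b₀)⟫_ℝ
              + s * ⟪r v₀, r (b + b₀)⟫_ℝ)) (⟪r v₀, r (b + b₀)⟫_ℝ) 0 := by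
            simpa using ((hasDerivAt_id (0 : ℝ)).mul_const ⟪r v₀, r (b + b₀)⟫_ℝ).const_add
              ⟪r (a + a₀), r (b + b₀)⟫_ℝ
          have h6 := ((h4.ofReal_comp.sub_const (‖r (b + b₀)‖ ^ 2 : ℂ)).const_mul
            (c / 2 : ℂ)).add ((h5.ofReal_comp.const_mul (c : ℂ)).const_mul Complex.I)
          refine (h6.congr_deriv ?_).congr_of_eventuallyEq (.of_forall fun s => ?_)
          · simp only [cEval, hh, real_inner_comm (r (a + a₀)) (r v₀)]
            push_cast
            ring
          · have e1 : ‖r (a + a₀ + s • v₀)‖ ^ 2 = ‖r (a + a₀)‖ ^ 2 +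
                2 * (s * ⟪r (a + a₀), r v₀⟫_ℝ) + (s * ‖r v₀‖) ^ 2 := by
              rw [map_add, map_smul, norm_add_sq_real, inner_smul_right, norm_smul, mul_pow,
                mul_pow, Real.norm_eq_abs, sq_abs]
            have e2 : ⟪r (a + a₀ + s • v₀), r (b + b₀)⟫_ℝ = ⟪r (a + a₀), r (b + b₀)⟫_ℝ
              + s * ⟪r v₀, r (b + b₀)⟫_ℝ := by
              rw [map_add r (a + a₀), inner_add_left, map_smul, real_inner_smul_left]
            simp only [Pi.add_apply]
            rw [← Complex.ofReal_pow ‖r (a + a₀ + s • v₀)‖, e1, e2]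
        convert h3.cexp using 1
        simp [mul_comm]
      have h7 := h1.unique h2
      rw [← hν.integral_exp_cEval, ← integral_const_mul] at h7
      have e2 : ∀ φ, cEval (a + a₀) (b + b₀) φ = cEval a b φ + cEval a₀ b₀ φ :=
        fun φ => cEval_add _ _ _ _ _
      simp only [e2, Complex.exp_add] at h7
      convert! h7.symm using 3
      · rename_i φ; ring
      · rename_i φ; simp only [cEval]; simp; ring
  | @add f g hf hg ihf ihg =>
    obtain ⟨f', hf', hfd, hfi⟩ := ihf
    obtain ⟨g', hg', hgd, hgi⟩ := ihg
    refine ⟨_, hf'.add hg', fun φ => (hfd φ).add (hgd φ), fun v₀ hh a b => ?_⟩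
    have i1 (h : Module.Dual ℝ V → ℂ) (hh : IsPolyExp h) :
        Integrable (fun φ => Complex.exp (cEval a b φ) * h φ) ν :=
      ((hν.hasAllMoments_exp a b).mul (hh.hasAllMoments hν)).integrable
    have e1 := integral_add (i1 _ (hf'.add (hf.const_mul (cEval a b h))))
      (i1 _ (hg'.add (hg.const_mul (cEval a b h))))
    have e2 := integral_add (i1 _ (hf.eval_mul v₀)) (i1 _ (hg.eval_mul v₀))
    rw [hfi v₀ hh, hgi v₀ hh, ← e2] at e1
    convert! e1 using 3 <;> ring
  | @const_mul z f hf ihf =>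
    obtain ⟨f', hf', hfd, hfi⟩ := ihf
    refine ⟨_, hf'.const_mul z, fun φ => (hfd φ).const_mul z, fun v₀ hh a b => ?_⟩
    have e1 := congrArg (fun x => z * x) (hfi v₀ hh a b)
    simp only [← integral_const_mul] at e1
    convert! e1 using 3 <;> ring
  | @eval_mul v f hf ihf =>
    obtain ⟨f', hf', hfd, hfi⟩ := ihf
    refine ⟨_, (hf.const_mul (h v)).add (hf'.eval_mul v), fun φ => ?_, fun v₀ hh a b => ?_⟩
    · have h1 : HasDerivAt (fun t : ℝ => (((φ + t • h) v : ℝ) : ℂ)) (h v) 0 := by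
        have : HasDerivAt (fun t : ℝ => φ v + t * h v) (h v) 0 := by
          simpa using ((hasDerivAt_id (0 : ℝ)).mul_const (h v)).const_add (φ v)
        simpa using this.ofReal_comp
      exact (h1.mul (hfd φ)).congr_deriv (by simp)
    · have i1 (a b : V) (h : Module.Dual ℝ V → ℂ) (hh : IsPolyExp h) :
          Integrable (fun φ => Complex.exp (cEval a b φ) * h φ) ν :=
        ((hν.hasAllMoments_exp a b).mul (hh.hasAllMoments hν)).integrable
      have hg := hf'.add (hf.const_mul (cEval a b h))
      have d1 := hν.hasDerivAt_integral_exp (hg.hasAllMoments hν).memLp_two a b v 0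
      have d2 := hν.hasDerivAt_integral_exp (hf.hasAllMoments hν).memLp_two a b v 0
      have d3 := hν.hasDerivAt_integral_exp ((hf.eval_mul v₀).hasAllMoments hν).memLp_two a b v 0
      have e (s : ℝ) (φ : Module.Dual ℝ V) : cEval a b φ + s * cEval v 0 φ =
          cEval (a + s • v) b φ := by
        rw [← cEval_smul, ← cEval_add, smul_zero, add_zero]
      have ev (φ : Module.Dual ℝ V) : cEval v 0 φ = φ v := by simp [cEval]
      have d4 := d1.add (((Complex.ofRealCLM.hasDerivAt (x := 0)).mul_const (h v : ℂ)).mul d2)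
      -- The induction hypothesis at `a + s • v`, where `cEval (a + s • v) b h` exceeds `cEval a b
      -- h` by `s * h v`. Its derivative at `s = 0` brings down the factor `φ v` and is the claim.
      have heq : (fun s : ℝ => ∫ φ, Complex.exp (cEval a b φ + s * cEval v 0 φ) *
          (φ v₀ * f φ) ∂ν) = (fun s : ℝ => ∫ φ, Complex.exp (cEval a b φ + s * cEval v 0 φ) *
            (f' φ + cEval a b h * f φ) ∂ν) + (fun s : ℝ => Complex.ofRealCLM s * (h v : ℂ)) *
            fun s : ℝ => ∫ φ, Complex.exp (cEval a b φ + s * cEval v 0 φ) * f φ ∂ν := by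
        ext s
        simp only [e, ← hfi v₀ hh, Pi.add_apply, Pi.mul_apply]
        rw [← integral_const_mul, ← integral_add (i1 _ _ _ hg) ((i1 _ _ _ hf).const_mul _)]
        refine integral_congr_ae (.of_forall fun φ => ?_)
        simp only [← e s h, ev, Complex.ofRealCLM_apply]
        ring
      have h7 := d3.unique (heq ▸ d4)
      simp only [ev, Complex.ofRealCLM_apply, Complex.ofReal_one, one_mul, Complex.ofReal_zero,
        zero_mul, add_zero] at h7
      have i2 : Integrable (fun φ => (φ v : ℂ) * (Complex.exp (cEval a b φ) *
          (f' φ + cEval a b h * f φ))) ν :=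
        (i1 a b _ (hg.eval_mul v)).congr (.of_forall fun φ => by ring)
      rw [← integral_const_mul, ← integral_add i2 ((i1 _ _ _ hf).const_mul _)] at h7
      convert! h7.symm using 3 <;> ring

end IsPolyExp

/-! ### Hilbert space preliminaries -/

theorem inner_toLp_eq_integral {Ω : Type*} [MeasurableSpace Ω] {ν : Measure Ω} {f : Ω → ℂ}
    (hf : MemLp f 2 ν) (g : Lp ℂ 2 ν) :
    ⟪hf.toLp f, g⟫_ℂ = ∫ φ, starRingEnd ℂ (f φ) * g φ ∂ν := by
  rw [L2.inner_def]
  refine integral_congr_ae ?_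
  filter_upwards [hf.coeFn_toLp] with φ h1
  rw [h1, RCLike.inner_apply, mul_comm]

theorem inner_toLp_toLp_eq_integral {Ω : Type*} [MeasurableSpace Ω] {ν : Measure Ω} {f g : Ω → ℂ}
    (hf : MemLp f 2 ν) (hg : MemLp g 2 ν) :
    ⟪hf.toLp f, hg.toLp g⟫_ℂ = ∫ φ, starRingEnd ℂ (f φ) * g φ ∂ν := by
  rw [inner_toLp_eq_integral]
  refine integral_congr_ae ?_
  filter_upwards [hg.coeFn_toLp] with φ h1
  rw [h1]

theorem denseRange_linearCombination_of_total {ι K : Type*} [NormedAddCommGroup K]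
    [InnerProductSpace ℂ K] [CompleteSpace K] (e : ι → K)
    (he : ∀ x, (∀ i, ⟪e i, x⟫_ℂ = 0) → x = 0) : DenseRange (Finsupp.linearCombination ℂ e) := by
  have h1 : (Submodule.span ℂ (Set.range e)).topologicalClosure = ⊤ := by
    rw [Submodule.topologicalClosure_eq_top_iff, Submodule.eq_bot_iff]
    exact fun x hx => he x fun i => hx _ (Submodule.subset_span ⟨i, rfl⟩)
  rw [← Finsupp.range_linearCombination] at h1
  exact Submodule.dense_iff_topologicalClosure_eq_top.2 h1

theorem inner_linearCombination_self {ι K : Type*} [NormedAddCommGroup K] [InnerProductSpace ℂ K]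
    (e : ι → K) (x : ι →₀ ℂ) :
    ⟪Finsupp.linearCombination ℂ e x, Finsupp.linearCombination ℂ e x⟫_ℂ =
      ∑ i ∈ x.support, x i * ∑ k ∈ x.support, starRingEnd ℂ (x k) * ⟪e k, e i⟫_ℂ := by
  simp only [Finsupp.linearCombination_apply, Finsupp.sum, sum_inner, inner_sum,
    inner_smul_left, inner_smul_right]

/-- Total families with equal Gram matrices in Hilbert spaces are isometrically equivalent. -/
theorem exists_linearIsometryEquiv_of_inner_eq {ι H₁ H₂ : Type*} [NormedAddCommGroup H₁]
    [InnerProductSpace ℂ H₁] [CompleteSpace H₁] [NormedAddCommGroup H₂] [InnerProductSpace ℂ H₂]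
    [CompleteSpace H₂] (e₁ : ι → H₁) (e₂ : ι → H₂)
    (h₁ : ∀ x, (∀ i, ⟪e₁ i, x⟫_ℂ = 0) → x = 0) (h₂ : ∀ x, (∀ i, ⟪e₂ i, x⟫_ℂ = 0) → x = 0)
    (h : ∀ i k, ⟪e₁ i, e₁ k⟫_ℂ = ⟪e₂ i, e₂ k⟫_ℂ) :
    ∃ U : H₁ ≃ₗᵢ[ℂ] H₂, ∀ i, U (e₁ i) = e₂ i := by
  -- Working with formal combinations avoids the question whether the map is well defined on spans:
  -- the families may be linearly dependent, and equal Gram matrices make the norms agree.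
  have hnorm (x : ι →₀ ℂ) : ‖Finsupp.linearCombination ℂ e₂ (LinearEquiv.refl ℂ (ι →₀ ℂ) x)‖ =
      ‖Finsupp.linearCombination ℂ e₁ x‖ := by
    have h1 : ⟪Finsupp.linearCombination ℂ e₂ x, Finsupp.linearCombination ℂ e₂ x⟫_ℂ =
        ⟪Finsupp.linearCombination ℂ e₁ x, Finsupp.linearCombination ℂ e₁ x⟫_ℂ := by
      simp only [inner_linearCombination_self, h]
    rw [inner_self_eq_norm_sq_to_K, inner_self_eq_norm_sq_to_K] at h1
    exact (sq_eq_sq₀ (norm_nonneg _) (norm_nonneg _)).1 (mod_cast h1)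
  have d₁ := denseRange_linearCombination_of_total e₁ h₁
  have d₂ := denseRange_linearCombination_of_total e₂ h₂
  refine ⟨(LinearEquiv.refl ℂ (ι →₀ ℂ)).extendOfIsometry _ _ d₁ d₂ hnorm, fun i => ?_⟩
  simpa using LinearEquiv.extendOfIsometry_eq (LinearEquiv.refl ℂ (ι →₀ ℂ)) _ _ d₁ d₂ hnorm
    (Finsupp.single i 1)

namespace AffineFieldTheory

variable {L : Type u} {A : Type*} [NormedAddCommGroup L] [InnerProductSpace ℝ L]
  [CompleteSpace L] [TopologicalSpace.SeparableSpace L] [MetricSpace A] [NormedAddTorsor L A]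
  (T : AffineFieldTheory L A)

/-! ### Linear algebra of the complex structure -/

theorem ω_def (τ ξ : L) : T.ω τ ξ = 1 / 2 * T.br τ ξ - 1 / 2 * T.br ξ τ := rfl

theorem inner_J_right (τ ξ : L) : ⟪τ, T.J ξ⟫_ℝ = -(2 * T.ω τ ξ) := by
  rw [T.inner_eq, T.J_J]
  simp only [symplecticForm, map_neg, neg_apply]
  ring

theorem inner_J_left (τ ξ : L) : ⟪T.J τ, ξ⟫_ℝ = 2 * T.ω τ ξ := by
  rw [real_inner_comm, inner_J_right]
  simp only [symplecticForm]
  ring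

theorem inner_J_J (τ ξ : L) : ⟪T.J τ, T.J ξ⟫_ℝ = ⟪τ, ξ⟫_ℝ := by
  rw [T.inner_J_left, T.inner_eq]

theorem inner_J_self (τ : L) : ⟪τ, T.J τ⟫_ℝ = 0 := by
  rw [T.inner_J_right]
  simp only [symplecticForm]
  ring

theorem norm_J (τ : L) : ‖T.J τ‖ = ‖τ‖ := by
  rw [← sq_eq_sq₀ (norm_nonneg _) (norm_nonneg _), ← real_inner_self_eq_norm_sq,
    ← real_inner_self_eq_norm_sq, T.inner_J_J]

theorem θ_eq (η ζ : A) (v : L) : T.θ ζ v = T.θ η v + T.br (ζ -ᵥ η) v := by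
  conv_lhs => rw [← vsub_vadd ζ η]
  exact T.θ_vadd _ _ _

/-! ### The Gaussian measure on `LHat` -/

theorem isAlgDualGaussian_νL : IsAlgDualGaussian
    (InnerProductSpace.toDual ℝ L).symm.toLinearEquiv.toLinearMap 1 T.νL := fun l => by
  rw [T.νL_spec l]
  congr 3
  exact ((InnerProductSpace.toDual ℝ L).symm.nnnorm_map l).symm

theorem isProbabilityMeasure_νL : IsProbabilityMeasure T.νL :=
  T.νL_spec.isProbabilityMeasure

/-- `L` is the Cameron–Martin space of `νL`: translation by `ξ` corresponds to the exponential tilt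
by `g(ξ, ·)`. -/
theorem inclL_eq_covariance (ξ : L) (l : StrongDual ℝ L) :
    T.inclL ξ l = (1 : ℝ≥0) *
      ⟪(InnerProductSpace.toDual ℝ L).symm.toLinearEquiv.toLinearMap (innerSL ℝ ξ),
        (InnerProductSpace.toDual ℝ L).symm.toLinearEquiv.toLinearMap l⟫_ℝ := by
  have h1 : (InnerProductSpace.toDual ℝ L).symm (innerSL ℝ ξ) = ξ :=
    (InnerProductSpace.toDual ℝ L).symm_apply_apply ξ
  have h2 : ⟪(InnerProductSpace.toDual ℝ L).symm l, ξ⟫_ℝ = l ξ :=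
    InnerProductSpace.toDual_symm_apply
  rw [real_inner_comm] at h2
  change l ξ = ((1 : ℝ≥0) : ℝ) * ⟪(InnerProductSpace.toDual ℝ L).symm (innerSL ℝ ξ),
    (InnerProductSpace.toDual ℝ L).symm l⟫_ℝ
  rw [h1, h2]
  simp

/-- Because `2 ω(τ, ·) = g(J τ, ·)`, both parts of the form are Riesz functionals. -/
theorem hermHat_eq (τ : L) (φ : T.LHat) :
    T.hermHat τ φ = cEval (innerSL ℝ τ) (innerSL ℝ (T.J τ)) φ := by
  have : innerSL ℝ (T.J τ) = (2 : ℝ) • T.ωL τ := by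
    ext ξ
    simp only [innerSL_apply_apply, T.inner_J_left, ωL, symplecticForm, smul_apply, smul_eq_mul,
      sub_apply, ContinuousLinearMap.flip_apply]
  rw [hermHat, cEval, this, map_smul]
  push_cast [smul_eq_mul]
  ring

theorem coherentL_eq (τ : L) (φ : T.LHat) : T.coherentL τ φ =
    Complex.exp (cEval ((1 / 2 : ℝ) • innerSL ℝ τ) ((1 / 2 : ℝ) • innerSL ℝ (T.J τ)) φ) := by
  rw [coherentL, T.hermHat_eq, cEval_smul]
  push_cast
  rfl

theorem memLp_coherentL (τ : L) : MemLp (T.coherentL τ) 2 T.νL :=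
  ((T.isAlgDualGaussian_νL.hasAllMoments_exp _ _).congr
    fun φ => (T.coherentL_eq τ φ).symm).memLp_two

theorem measurable_hermHat (τ : L) : Measurable (T.hermHat τ) := by
  rw [funext (T.hermHat_eq τ)]
  exact measurable_cEval _ _

theorem hermHat_add (τ : L) (φ ψ : T.LHat) :
    T.hermHat τ (φ + ψ) = T.hermHat τ φ + T.hermHat τ ψ := by
  simp only [T.hermHat_eq, cEval_add_dual]

/-- The action on `LHat` of the phase rotation `exp (t J)` of `L`. -/
def rotation (t : ℝ) : StrongDual ℝ L →ₗ[ℝ] StrongDual ℝ L :=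
  (InnerProductSpace.toDual ℝ L).toLinearEquiv.toLinearMap.comp
    ((Real.cos t • LinearMap.id - Real.sin t • T.J).comp
      (InnerProductSpace.toDual ℝ L).symm.toLinearEquiv.toLinearMap)

theorem rotation_innerSL (t : ℝ) (τ : L) : T.rotation t (innerSL ℝ τ) =
    Real.cos t • innerSL ℝ τ - Real.sin t • innerSL ℝ (T.J τ) := by
  have h1 : (InnerProductSpace.toDual ℝ L).symm (innerSL ℝ τ) = τ :=
    (InnerProductSpace.toDual ℝ L).symm_apply_apply τ
  change InnerProductSpace.toDual ℝ L (Real.cos t • (InnerProductSpace.toDual ℝ L).symm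
    (innerSL ℝ τ) - Real.sin t • T.J ((InnerProductSpace.toDual ℝ L).symm (innerSL ℝ τ))) = _
  rw [h1]
  ext ξ
  simp

/-- `J τ` is orthogonal to `τ` and has the same length, so the claim is `cos² + sin² = 1`. -/
theorem norm_rotation (t : ℝ) (l : StrongDual ℝ L) : ‖T.rotation t l‖ = ‖l‖ := by
  obtain ⟨τ, rfl⟩ := (InnerProductSpace.toDual ℝ L).surjective l
  change ‖InnerProductSpace.toDual ℝ L (Real.cos t • (InnerProductSpace.toDual ℝ L).symm
    (InnerProductSpace.toDual ℝ L τ) - Real.sin t • T.J ((InnerProductSpace.toDual ℝ L).symm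
    (InnerProductSpace.toDual ℝ L τ)))‖ = _
  rw [LinearIsometryEquiv.symm_apply_apply, LinearIsometryEquiv.norm_map,
    LinearIsometryEquiv.norm_map, ← sq_eq_sq₀ (norm_nonneg _) (norm_nonneg _), norm_sub_sq_real,
    norm_smul, norm_smul, T.norm_J, real_inner_smul_left, inner_smul_right, T.inner_J_self, mul_pow,
    mul_pow, Real.norm_eq_abs, Real.norm_eq_abs, sq_abs, sq_abs]
  linear_combination ‖τ‖ ^ 2 * Real.cos_sq_add_sin_sq t

/-- The rotation preserves all variances, and these determine the measure. -/
theorem measurePreserving_rotation (t : ℝ) :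
    MeasurePreserving (fun φ : T.LHat => φ.comp (T.rotation t)) T.νL T.νL := by
  have hm : Measurable (fun φ : T.LHat => φ.comp (T.rotation t)) :=
    measurable_algDual_iff.2 fun l => measurable_algDual_eval (T.rotation t l)
  refine ⟨hm, ?_⟩
  refine IsBidualGaussian.unique (c := 1) (fun l => ?_) T.νL_spec
  rw [Measure.map_map (measurable_algDual_eval l) hm]
  refine (T.νL_spec (T.rotation t l)).trans ?_
  congr 3
  exact NNReal.eq (T.norm_rotation t l)

/-- The minus sign in `rotation` makes the phase `exp (i t)` and not its conjugate, so a rotation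
acts on cylinder coordinates by a scalar. -/
theorem hermHat_rotation (t : ℝ) (τ : L) (φ : T.LHat) :
    T.hermHat τ (φ.comp (T.rotation t)) = Complex.exp (t * Complex.I) * T.hermHat τ φ := by
  simp only [T.hermHat_eq, cEval, LinearMap.comp_apply, T.rotation_innerSL, T.J_J, map_sub, map_neg,
    map_smul, smul_eq_mul, Complex.exp_mul_I]
  push_cast
  linear_combination (-(Complex.sin t * φ (innerSL ℝ (T.J τ)))) * Complex.I_sq

/-- The mean value property of holomorphic cylinder functions. -/
theorem integral_cylinder_eq {n : ℕ} (τ : Fin n → L) {p : (Fin n → ℂ) → ℂ}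
    (hp : Differentiable ℂ p) (w : Fin n → ℂ)
    (hint : Integrable (fun φ => p ((fun i => T.hermHat (τ i) φ) + w)) T.νL) :
    ∫ φ, p ((fun i => T.hermHat (τ i) φ) + w) ∂T.νL = p w := by
  have := T.isProbabilityMeasure_νL
  let Z : T.LHat → Fin n → ℂ := fun φ i => T.hermHat (τ i) φ
  have hZ : Measurable Z := measurable_pi_lambda _ fun i => T.measurable_hermHat _
  -- The mean of `F` over both variables is computed in two orders. The integral over `φ` does not
  -- depend on `t`, by invariance of the measure; for fixed `φ` the mean over `t` is the value `p w`
  -- at the centre of a circle.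
  let F : ℝ → T.LHat → ℂ := fun t φ => p (Complex.exp (t * Complex.I) • Z φ + w)
  have hF (t : ℝ) : F t = (fun φ => p (Z φ + w)) ∘ fun φ => φ.comp (T.rotation t) := by
    ext φ
    simp only [F, Function.comp, Z, T.hermHat_rotation]
    rfl
  have hFint (t : ℝ) : Integrable (F t) T.νL := by
    rw [hF]
    exact (T.measurePreserving_rotation t).integrable_comp_of_integrable hint
  have hpm : Measurable p := hp.continuous.measurable
  have hcomp (G : (Fin n → ℂ) → ℂ) (hG : Measurable G) (t : ℝ) :
      ∫ φ, G (Complex.exp (t * Complex.I) • Z φ + w) ∂T.νL = ∫ φ, G (Z φ + w) ∂T.νL := by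
    have h1 := integral_map (μ := T.νL) (T.measurePreserving_rotation t).measurable.aemeasurable
      (f := fun φ => G (Z φ + w)) (hG.comp (hZ.add_const w)).aestronglyMeasurable
    rw [(T.measurePreserving_rotation t).map_eq] at h1
    rw [h1]
    refine integral_congr_ae (.of_forall fun φ => ?_)
    simp only [Z, T.hermHat_rotation]
    rfl
  have hFm : Measurable (Function.uncurry F) := by
    have h1 : Continuous fun t : ℝ => Complex.exp (t * Complex.I) := by fun_prop
    have h2 : Measurable fun a : ℝ × T.LHat => Complex.exp (a.1 * Complex.I) • Z a.2 :=
      (h1.measurable.comp measurable_fst).smul (hZ.comp measurable_snd)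
    exact hpm.comp (h2.add_const w)
  -- Fubini applies because the `L¹` norm of the rotated integrand is constant in `t`.
  have hprod : Integrable (Function.uncurry F)
      ((volume.restrict (Set.Ioc 0 (2 * Real.pi))).prod T.νL) := by
    rw [integrable_prod_iff hFm.aestronglyMeasurable]
    refine ⟨.of_forall hFint, ?_⟩
    have : (fun t => ∫ φ, ‖Function.uncurry F (t, φ)‖ ∂T.νL) = fun _ => ∫ φ, ‖p (Z φ + w)‖ ∂T.νL := by
      ext t
      have := hcomp (fun z => ‖p z‖) (Complex.measurable_ofReal.comp hpm.norm) t
      simp only [integral_complex_ofReal] at this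
      exact_mod_cast this
    rw [this]
    exact integrable_const _
  have hswap := integral_integral_swap hprod
  have h1 (φ : T.LHat) : ∫ t in Set.Ioc 0 (2 * Real.pi), F t φ = 2 * Real.pi * p w := by
    have hd : Differentiable ℂ fun z : ℂ => p (z • Z φ + w) := by fun_prop
    have h2 := (hd.diffContOnCl (s := Metric.ball 0 |1|)).circleAverage
    rw [Real.circleAverage, intervalIntegral.integral_of_le (by positivity)] at h2
    simp only [circleMap, zero_add, Complex.ofReal_one, one_mul, zero_smul] at h2
    rw [← h2, Complex.real_smul]
    push_cast
    rw [← mul_assoc, mul_inv_cancel₀ (by simp [Real.pi_ne_zero]), one_mul]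
  simp only [h1, F, hcomp p hpm, integral_const, measureReal_restrict_apply MeasurableSet.univ,
    Set.univ_inter, Real.volume_real_Ioc_of_le (by positivity : (0 : ℝ) ≤ 2 * Real.pi), sub_zero,
    probReal_univ, one_smul] at hswap
  rw [Complex.real_smul] at hswap
  have h3 : (2 * Real.pi : ℂ) ≠ 0 := by simp [Real.pi_ne_zero]
  push_cast at hswap
  exact mul_left_cancel₀ h3 hswap

/-! ### The reproducing property of the holomorphic representation -/

/-- Lets the holomorphic factor of a conjugated coherent state be absorbed into the function it is
paired with. -/
theorem IsCylinderHolomorphic.mul_exp {T : AffineFieldTheory L A} {f : T.LHat → ℂ}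
    (hf : T.IsCylinderHolomorphic f) (z : ℂ) (τ : L) :
    T.IsCylinderHolomorphic fun φ => f φ * Complex.exp (z * T.hermHat τ φ) := by
  obtain ⟨n, σ, p, hp, hfp⟩ := hf
  refine ⟨n + 1, Fin.cons τ σ, fun w => p (fun i => w i.succ) * Complex.exp (z * w 0), ?_, ?_⟩
  · fun_prop
  · intro φ
    simp [hfp]

theorem isCylinderHolomorphic_coherentL (τ : L) : T.IsCylinderHolomorphic (T.coherentL τ) :=
  ⟨1, fun _ => τ, fun w => Complex.exp (1 / 2 * w 0), by fun_prop, fun _ => rfl⟩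

theorem IsCylinderHolomorphic.integral_comp_add {T : AffineFieldTheory L A} {f : T.LHat → ℂ}
    (hf : T.IsCylinderHolomorphic f) (ξ : L)
    (hint : Integrable (fun φ => f (φ + T.inclL ξ)) T.νL) :
    ∫ φ, f (φ + T.inclL ξ) ∂T.νL = f (T.inclL ξ) := by
  obtain ⟨n, σ, p, hp, hfp⟩ := hf
  have h (φ : T.LHat) : f (φ + T.inclL ξ) =
      p ((fun i => T.hermHat (σ i) φ) + fun i => T.hermHat (σ i) (T.inclL ξ)) := by
    rw [hfp]
    simp only [T.hermHat_add]
    rfl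
  simp only [h] at hint ⊢
  rw [T.integral_cylinder_eq σ hp _ hint, hfp]

theorem IsCylinderHolomorphic.measurable {T : AffineFieldTheory L A} {f : T.LHat → ℂ}
    (hf : T.IsCylinderHolomorphic f) : Measurable f := by
  obtain ⟨n, σ, p, hp, hfp⟩ := hf
  rw [funext hfp]
  exact hp.continuous.measurable.comp (measurable_pi_lambda _ fun i => T.measurable_hermHat _)

/-- Cameron–Martin turns the weight into a translation by `ξ`, and the mean value property
evaluates. Compared with `integral_conj_coherentL_mul`, this is what yields injectivity of the
restriction to `L`. -/
theorem integral_exp_mul_cylinder {f : T.LHat → ℂ} (hf : T.IsCylinderHolomorphic f)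
    (hf2 : MemLp f 2 T.νL) (ξ : L) :
    ∫ φ, (Real.exp (φ (innerSL ℝ ξ) - ‖ξ‖ ^ 2 / 2) : ℂ) * f φ ∂T.νL = f (T.inclL ξ) := by
  have hν := T.isAlgDualGaussian_νL
  have h1 := (hν.integrable_comp_shift (T.inclL_eq_covariance ξ) f).2
    ((hν.memLp_exp _ (by norm_num : (2 : ℝ≥0∞) ≠ ∞)).ofReal.integrable_mul hf2)
  rw [← hf.integral_comp_add ξ h1, hν.integral_comp_shift (T.inclL_eq_covariance ξ)]
  simp

theorem hermHat_inclL_self (ξ : L) : T.hermHat ξ (T.inclL ξ) = (‖ξ‖ ^ 2 : ℝ) := by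
  rw [T.hermHat_incl, herm, real_inner_self_eq_norm_sq, ω_def]
  simp

theorem conj_hermHat (τ : L) (φ : T.LHat) :
    starRingEnd ℂ (T.hermHat τ φ) = 2 * φ (innerSL ℝ τ) - T.hermHat τ φ := by
  rw [T.hermHat_eq, conj_cEval, cEval, cEval, map_neg]
  push_cast
  ring

/-- Writing the conjugate as twice the real part minus the number splits an antiholomorphic
exponential into a real weight, which acts as a translation, and a holomorphic factor. -/
theorem conj_coherentL (τ : L) (φ : T.LHat) : starRingEnd ℂ (T.coherentL τ φ) =
    Real.exp (φ (innerSL ℝ τ)) * Complex.exp (-1 / 2 * T.hermHat τ φ) := by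
  rw [coherentL, ← Complex.exp_conj, map_mul, T.conj_hermHat, Complex.ofReal_exp, ← Complex.exp_add]
  congr 1
  simp only [map_div₀, map_one, map_ofNat]
  ring

/-- The pairing of a holomorphic cylinder function with coherent states is evaluation. -/
theorem integral_conj_coherentL_mul {f : T.LHat → ℂ} (hf : T.IsCylinderHolomorphic f)
    (hf2 : MemLp f 2 T.νL) (ξ : L) :
    ∫ φ, starRingEnd ℂ (T.coherentL ξ φ) * f φ ∂T.νL = f (T.inclL ξ) := by
  have hν := T.isAlgDualGaussian_νL
  have hint : Integrable (fun φ => starRingEnd ℂ (T.coherentL ξ φ) * f φ) T.νL :=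
    (T.memLp_coherentL ξ).star.integrable_mul hf2
  -- The value at `ξ` of the holomorphic factor is `exp (-½ ‖ξ‖²)`, which cancels the normalization
  -- of the Cameron–Martin density.
  have hg := hf.mul_exp (-1 / 2) ξ
  have h1 := (hν.integrable_comp_shift (T.inclL_eq_covariance ξ)
    (fun φ => f φ * Complex.exp (-1 / 2 * T.hermHat ξ φ))).2 (hint.congr (.of_forall fun φ => by
      simp only [T.conj_coherentL]; ring))
  have h2 := hg.integral_comp_add ξ h1
  rw [hν.integral_comp_shift (T.inclL_eq_covariance ξ)
    (fun φ => f φ * Complex.exp (-1 / 2 * T.hermHat ξ φ)), T.hermHat_inclL_self] at h2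
  have h3 : (InnerProductSpace.toDual ℝ L).symm.toLinearEquiv.toLinearMap (innerSL ℝ ξ) = ξ :=
    (InnerProductSpace.toDual ℝ L).symm_apply_apply ξ
  have h4 (φ : T.LHat) : (Real.exp (φ (innerSL ℝ ξ) - ((1 : ℝ≥0) : ℝ) * ‖ξ‖ ^ 2 / 2) : ℂ) *
      (f φ * Complex.exp (-1 / 2 * T.hermHat ξ φ)) =
      Complex.exp (-1 / 2 * (‖ξ‖ ^ 2 : ℝ)) * (starRingEnd ℂ (T.coherentL ξ φ) * f φ) := by
    rw [T.conj_coherentL, sub_eq_add_neg, Real.exp_add]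
    push_cast
    rw [show -((1 : ℂ) * ‖ξ‖ ^ 2 / 2) = -1 / 2 * (‖ξ‖ ^ 2 : ℂ) by ring]
    ring
  simp only [h3, h4] at h2
  rw [integral_const_mul, mul_comm (f _)] at h2
  exact mul_left_cancel₀ (Complex.exp_ne_zero _) h2

theorem restrictL_eq_of_cylinder {p : T.LHat → ℂ} {f : T.H2} (hp : T.IsCylinderHolomorphic p)
    (hf : (f : Lp ℂ 2 T.νL) =ᵐ[T.νL] p) (ξ : L) : T.restrictL f ξ = p (T.inclL ξ) := by
  rw [← T.integral_conj_coherentL_mul hp ((memLp_congr_ae hf).1 (Lp.memLp _)) ξ]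
  refine integral_congr_ae ?_
  filter_upwards [hf] with φ h1
  rw [h1]

/-- The coherent state of `τ` as an element of `H²`. -/
def coherentH2 (τ : L) : T.H2 :=
  ⟨(T.memLp_coherentL τ).toLp (T.coherentL τ), Submodule.le_topologicalClosure _
    (Submodule.subset_span ⟨_, T.isCylinderHolomorphic_coherentL τ, MemLp.coeFn_toLp _⟩)⟩

theorem restrictL_eq_inner (f : T.H2) (ξ : L) : T.restrictL f ξ = ⟪T.coherentH2 ξ, f⟫_ℂ :=
  (inner_toLp_eq_integral (T.memLp_coherentL ξ) (f : Lp ℂ 2 T.νL)).symm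

theorem restrictL_coherentH2 (τ ξ : L) :
    T.restrictL (T.coherentH2 τ) ξ = Complex.exp (1 / 2 * T.herm τ ξ) := by
  rw [T.restrictL_eq_of_cylinder (T.isCylinderHolomorphic_coherentL τ)
    (MemLp.coeFn_toLp (T.memLp_coherentL τ)), coherentL, T.hermHat_incl]

/-- If `f` vanishes on `L`, it is orthogonal to all coherent states. These represent the same
functionals on `H²` as normalized real exponentials, so `f` is orthogonal to a total family of `L²`.
-/
theorem eq_zero_of_restrictL_eq_zero (f : T.H2) (hf : ∀ ξ, T.restrictL f ξ = 0) : f = 0 := by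
  have hν := T.isAlgDualGaussian_νL
  have hexp (ξ : L) : MemLp (fun φ : T.LHat =>
      (Real.exp (φ (innerSL ℝ ξ) - ‖ξ‖ ^ 2 / 2) : ℂ)) 2 T.νL := by
    have := ((hν.memLp_exp (innerSL ℝ ξ) (by norm_num : (2 : ℝ≥0∞) ≠ ∞)).mul_const
      (Real.exp (-(‖ξ‖ ^ 2 / 2)))).ofReal (K := ℂ)
    refine (memLp_congr_ae (.of_forall fun φ => ?_)).1 this
    rw [sub_eq_add_neg, Real.exp_add]
    rfl
  have hd (ξ : L) := (hexp ξ).sub (T.memLp_coherentL ξ)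
  -- Real exponential and coherent state agree as functionals on cylinder functions; the orthogonal
  -- complement of their difference is closed, so it contains all of `H²`.
  have hle (ξ : L) : T.H2 ≤ (Submodule.span ℂ {(hd ξ).toLp _})ᗮ := by
    refine Submodule.topologicalClosure_minimal _ (Submodule.span_le.2 ?_)
      (Submodule.isClosed_orthogonal _)
    rintro g ⟨p, hp, hgp⟩
    have hp2 := (memLp_congr_ae hgp).1 (Lp.memLp g)
    refine Submodule.mem_orthogonal_singleton_iff_inner_right.2 ?_
    have h1 : g = hp2.toLp p := (Lp.ext (hgp.trans hp2.coeFn_toLp.symm))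
    rw [h1, MemLp.toLp_sub (hexp ξ) (T.memLp_coherentL ξ), inner_sub_left,
      inner_toLp_toLp_eq_integral, inner_toLp_toLp_eq_integral,
      T.integral_conj_coherentL_mul hp hp2]
    simp only [Complex.conj_ofReal]
    rw [T.integral_exp_mul_cylinder hp hp2, sub_self]
  have h0 (ξ : L) : ∫ φ, (Real.exp (φ (innerSL ℝ ξ) - ‖ξ‖ ^ 2 / 2) : ℂ) *
      (f : Lp ℂ 2 T.νL) φ ∂T.νL = 0 := by
    have h1 := Submodule.mem_orthogonal_singleton_iff_inner_right.1 (hle ξ f.2)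
    rw [MemLp.toLp_sub (hexp ξ) (T.memLp_coherentL ξ), inner_sub_left, inner_toLp_eq_integral,
      inner_toLp_eq_integral] at h1
    have h2 : ∫ φ, starRingEnd ℂ (T.coherentL ξ φ) * (f : Lp ℂ 2 T.νL) φ ∂T.νL = 0 := hf ξ
    rw [h2, sub_zero] at h1
    simpa only [Complex.conj_ofReal] using h1
  have hz := hν.eq_zero_of_integral_exp_eq_zero (Lp.memLp (f : Lp ℂ 2 T.νL)) fun l => by
    obtain ⟨ξ, rfl⟩ := (InnerProductSpace.toDual ℝ L).surjective l
    have h1 := h0 ξ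
    have h2 (φ : T.LHat) : (Real.exp (φ (innerSL ℝ ξ) - ‖ξ‖ ^ 2 / 2) : ℂ) *
        (f : Lp ℂ 2 T.νL) φ = (Real.exp (-(‖ξ‖ ^ 2 / 2)) : ℂ) *
          ((Real.exp (φ (innerSL ℝ ξ)) : ℂ) * (f : Lp ℂ 2 T.νL) φ) := by
      rw [sub_eq_add_neg, Real.exp_add, Complex.ofReal_mul]
      ring
    simp only [h2] at h1
    rw [integral_const_mul] at h1
    exact (mul_eq_zero.1 h1).resolve_left (Complex.ofReal_ne_zero.2 (Real.exp_ne_zero _))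
  exact Subtype.ext ((Lp.eq_zero_iff_ae_eq_zero).2 hz)

/-! ### Wave functions on `A` -/

theorem conj_α (η ζ : A) : starRingEnd ℂ (T.α ζ η) = T.α η ζ := by
  rw [α, α, ← Complex.exp_conj]
  congr 1
  have h1 : η -ᵥ ζ = -(ζ -ᵥ η) := (neg_vsub_eq_vsub_rev ζ η).symm
  rw [h1]
  simp only [map_neg, inner_neg_neg, map_sub, map_add, map_mul, map_div₀, Complex.conj_I,
    Complex.conj_ofReal, map_one, map_ofNat]
  push_cast
  ring

theorem α_ne_zero (η ζ : A) : T.α η ζ ≠ 0 := Complex.exp_ne_zero _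

/-- The linear kernel, dressed with `α` on both sides, forgets the base point `η`. This dictates the
prefactor in `coherentH2At`. -/
theorem α_mul_exp_herm (η ζ ζ' : A) :
    T.α ζ η * Complex.exp (1 / 2 * T.herm (ζ -ᵥ η) (ζ' -ᵥ η)) * T.α η ζ' = T.α ζ ζ' := by
  simp only [α, ← Complex.exp_add]
  congr 1
  have h1 : η -ᵥ ζ = -(ζ -ᵥ η) := (neg_vsub_eq_vsub_rev ζ η).symm
  have h2 : ζ' -ᵥ ζ = (ζ' -ᵥ η) - (ζ -ᵥ η) := (vsub_sub_vsub_cancel_right ζ' ζ η).symm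
  rw [h1, h2, herm]
  simp only [T.θ_eq η ζ, T.θ_eq η ζ', ω_def, map_neg, map_sub, inner_neg_neg, inner_sub_left,
    inner_sub_right, real_inner_comm (ζ' -ᵥ η) (ζ -ᵥ η)]
  push_cast
  ring

/-- The coherent state of `ζ` presented relative to the base point `η`. -/
def coherentH2At (η ζ : A) : T.H2 := T.α ζ η • T.coherentH2 (ζ -ᵥ η)

theorem waveH_eq_inner (η : A) (f : T.H2) (ζ : A) :
    T.waveH η f ζ = ⟪T.coherentH2At η ζ, f⟫_ℂ := by
  rw [coherentH2At, waveH, T.restrictL_eq_inner, mul_comm, ← T.conj_α]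
  exact (inner_smul_left (𝕜 := ℂ) (T.coherentH2 (ζ -ᵥ η)) f (T.α ζ η)).symm

theorem waveH_coherentH2At (η ζ : A) : T.waveH η (T.coherentH2At η ζ) = T.coherentH ζ := by
  ext ζ'
  have h1 : ⟪T.coherentH2 (ζ' -ᵥ η), T.α ζ η • T.coherentH2 (ζ -ᵥ η)⟫_ℂ =
      T.α ζ η * ⟪T.coherentH2 (ζ' -ᵥ η), T.coherentH2 (ζ -ᵥ η)⟫_ℂ :=
    inner_smul_right (𝕜 := ℂ) _ (T.coherentH2 (ζ -ᵥ η)) (T.α ζ η)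
  rw [waveH, T.restrictL_eq_inner, coherentH2At, h1, ← T.restrictL_eq_inner,
    T.restrictL_coherentH2, T.α_mul_exp_herm, coherentH]

/-- The Gram matrix does not involve `η`; independence of the base point for `HHat` and its norm
rests on this. -/
theorem inner_coherentH2At (η ζ ζ' : A) :
    ⟪T.coherentH2At η ζ, T.coherentH2At η ζ'⟫_ℂ = T.α ζ' ζ := by
  rw [← T.waveH_eq_inner, T.waveH_coherentH2At, coherentH]

theorem coherentH2At_total (η : A) (f : T.H2) (hf : ∀ ζ, ⟪T.coherentH2At η ζ, f⟫_ℂ = 0) :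
    f = 0 := by
  refine T.eq_zero_of_restrictL_eq_zero f fun ξ => ?_
  have h1 := hf (ξ +ᵥ η)
  rw [← T.waveH_eq_inner, waveH, vadd_vsub] at h1
  exact (mul_eq_zero.1 h1).resolve_right (T.α_ne_zero _ _)

theorem isClosed_H2 : IsClosed (T.H2 : Set (Lp ℂ 2 T.νL)) :=
  Submodule.isClosed_topologicalClosure _

instance completeSpace_H2 : CompleteSpace T.H2 := T.isClosed_H2.completeSpace_coe

theorem waveH_injective (η : A) : Function.Injective (T.waveH η) := by
  intro f f' h
  rw [← sub_eq_zero]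
  refine T.coherentH2At_total η _ fun ζ => ?_
  rw [inner_sub_right, ← T.waveH_eq_inner, ← T.waveH_eq_inner, h, sub_self]

/-- The unitary matching the coherent families at the two base points preserves pairings with them,
and these pairings are the values of wave functions. -/
theorem exists_waveH_eq (η η' : A) : ∃ U : T.H2 ≃ₗᵢ[ℂ] T.H2,
    ∀ f, T.waveH η (U f) = T.waveH η' f := by
  obtain ⟨U, hU⟩ := exists_linearIsometryEquiv_of_inner_eq (T.coherentH2At η') (T.coherentH2At η)
    (T.coherentH2At_total η') (T.coherentH2At_total η)
    fun ζ ζ' => by rw [T.inner_coherentH2At, T.inner_coherentH2At]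
  refine ⟨U, fun f => funext fun ζ => ?_⟩
  rw [T.waveH_eq_inner, T.waveH_eq_inner, ← hU, U.inner_map_map]

theorem bijOn_waveH (η : A) : Set.BijOn (T.waveH η) Set.univ T.HHat := by
  refine ⟨fun f _ => ⟨η, f, rfl⟩, (T.waveH_injective η).injOn, ?_⟩
  rintro _ ⟨η', f, rfl⟩
  obtain ⟨U, hU⟩ := T.exists_waveH_eq η η'
  exact ⟨U f, trivial, hU f⟩

theorem norm_eq_of_waveH_eq {η η' : A} {f f' : T.H2} (h : T.waveH η f = T.waveH η' f') :
    ‖f‖ = ‖f'‖ := by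
  obtain ⟨U, hU⟩ := T.exists_waveH_eq η η'
  rw [← hU] at h
  rw [T.waveH_injective η h, U.norm_map]

/-! ### Linear algebra of the polarization -/

theorem br_right_of_mem_M (ξ : L) {m : L} (hm : m ∈ T.M) : T.br ξ m = 0 := hm ξ

theorem brQ_q (ξ τ : L) : T.brQ ξ (T.q τ) = T.br ξ τ := rfl

theorem brQ_add (ξ τ : L) : T.brQ (ξ + τ) = T.brQ ξ + T.brQ τ := by
  ext φ
  obtain ⟨σ, rfl⟩ := T.M.mkQ_surjective φ
  change T.br (ξ + τ) σ = T.br ξ σ + T.br τ σ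
  rw [map_add]; rfl

theorem brQ_smul (s : ℝ) (ξ : L) : T.brQ (s • ξ) = s • T.brQ ξ := by
  ext φ
  obtain ⟨σ, rfl⟩ := T.M.mkQ_surjective φ
  change T.br (s • ξ) σ = s • T.br ξ σ
  rw [map_smul]; rfl

theorem gQ_add (χ χ' : T.Q) : T.gQ (χ + χ') = T.gQ χ + T.gQ χ' := by
  simp only [gQ, map_add, ContinuousLinearMap.add_comp]

theorem gQ_smul (s : ℝ) (χ : T.Q) : T.gQ (s • χ) = s • T.gQ χ := by
  ext φ
  simp [gQ]

theorem gQ_apply (χ χ' : T.Q) : T.gQ χ χ' = ⟪T.j χ, T.j χ'⟫_ℝ := rfl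

theorem j_mem_orthogonal (χ : T.Q) : T.j χ ∈ T.Mᗮ := T.map_J_le_orthogonal (T.j_mem χ)

theorem sub_j_q_mem (ξ : L) : ξ - T.j (T.q ξ) ∈ T.M := by
  rw [← Submodule.Quotient.mk_eq_zero, ← Submodule.mkQ_apply, ← T.M.mkQL_apply, map_sub, T.q_j,
    sub_self]

theorem inner_j_j_q (χ : T.Q) (ξ : L) : ⟪T.j χ, T.j (T.q ξ)⟫_ℝ = ⟪T.j χ, ξ⟫_ℝ := by
  have h1 : ⟪ξ - T.j (T.q ξ), T.j χ⟫_ℝ = 0 := T.j_mem_orthogonal χ _ (T.sub_j_q_mem ξ)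
  rw [real_inner_comm, inner_sub_right] at h1
  linarith

theorem J_mem_orthogonal {m : L} (hm : m ∈ T.M) : T.J m ∈ T.Mᗮ :=
  T.map_J_le_orthogonal ⟨m, hm, rfl⟩

theorem j_q_of_mem_orthogonal {ξ : L} (hξ : ξ ∈ T.Mᗮ) : T.j (T.q ξ) = ξ := by
  have h1 := Submodule.sub_mem _ hξ (T.j_mem_orthogonal (T.q ξ)) _ (T.sub_j_q_mem ξ)
  exact (sub_eq_zero.1 (inner_self_eq_zero.1 h1)).symm

theorem br_left_of_mem_M {m : L} (hm : m ∈ T.M) (ξ : L) : T.br m ξ = ⟪T.J m, ξ⟫_ℝ := by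
  rw [T.inner_J_left, ω_def, T.br_right_of_mem_M ξ hm]
  ring

/-- One term of `ω(m, ·)` vanishes on `M`, so `[m, ·] = g(J m, ·)`, and `J m` already lies in the
range of `j`. -/
theorem brQ_of_mem_M {m : L} (hm : m ∈ T.M) : T.brQ m = T.gQ (T.q (T.J m)) := by
  ext φ
  obtain ⟨σ, rfl⟩ := T.M.mkQ_surjective φ
  change T.br m σ = ⟪T.j (T.q (T.J m)), T.j (T.q σ)⟫_ℝ
  rw [T.inner_j_j_q, T.j_q_of_mem_orthogonal (T.J_mem_orthogonal hm), T.br_left_of_mem_M hm]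

/-- `Mᗮ = J M` is isotropic because `M` is and `J` is symplectic; vanishing of `ω` is symmetry of
the bracket. This makes `Ω` symmetric. -/
theorem br_comm_of_mem_orthogonal {a b : L} (ha : a ∈ T.Mᗮ) (hb : b ∈ T.Mᗮ) :
    T.br a b = T.br b a := by
  obtain ⟨m, hm, rfl⟩ := T.orthogonal_le_map_J ha
  obtain ⟨n, hn, rfl⟩ := T.orthogonal_le_map_J hb
  have h1 := T.J_symplectic m n
  rw [symplecticForm, symplecticForm, hm n, hn m] at h1
  linarith

theorem Ω_q (ξ τ : L) : T.Ω (T.q ξ) (T.q τ) =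
    ⟪T.j (T.q ξ), T.j (T.q τ)⟫_ℝ - Complex.I * T.br (T.j (T.q ξ)) (T.j (T.q τ)) := by
  rw [Ω]
  conv_lhs => rw [← T.q_j (T.q τ), T.brQ_q, T.q_j]

theorem Ω_comm (χ χ' : T.Q) : T.Ω χ χ' = T.Ω χ' χ := by
  obtain ⟨ξ, rfl⟩ := T.M.mkQ_surjective χ
  obtain ⟨τ, rfl⟩ := T.M.mkQ_surjective χ'
  change T.Ω (T.q ξ) (T.q τ) = T.Ω (T.q τ) (T.q ξ)
  rw [T.Ω_q, T.Ω_q, real_inner_comm, T.br_comm_of_mem_orthogonal (T.j_mem_orthogonal _)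
    (T.j_mem_orthogonal _)]

theorem ΩHat_add_left (χ χ' : T.Q) (φ : T.QHat) :
    T.ΩHat (χ + χ') φ = T.ΩHat χ φ + T.ΩHat χ' φ := by
  simp only [ΩHat, gQ_add, map_add, brQ_add]
  push_cast
  ring

theorem ΩHat_smul_left (s : ℝ) (χ : T.Q) (φ : T.QHat) :
    T.ΩHat (s • χ) φ = s * T.ΩHat χ φ := by
  simp only [ΩHat, gQ_smul, map_smul, brQ_smul, smul_eq_mul]
  push_cast
  ring

theorem Ω_add_left (χ χ' ρ : T.Q) : T.Ω (χ + χ') ρ = T.Ω χ ρ + T.Ω χ' ρ :=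
  T.ΩHat_add_left χ χ' (T.inclQ ρ)

theorem Ω_smul_left (s : ℝ) (χ ρ : T.Q) : T.Ω (s • χ) ρ = s * T.Ω χ ρ :=
  T.ΩHat_smul_left s χ (T.inclQ ρ)

theorem Ω_add_right (χ χ' ρ : T.Q) : T.Ω ρ (χ + χ') = T.Ω ρ χ + T.Ω ρ χ' := by
  rw [T.Ω_comm, T.Ω_add_left, T.Ω_comm χ, T.Ω_comm χ']

theorem Ω_smul_right (s : ℝ) (χ ρ : T.Q) : T.Ω ρ (s • χ) = s * T.Ω ρ χ := by
  rw [T.Ω_comm, T.Ω_smul_left, T.Ω_comm]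

theorem ΩHat_add_right (χ : T.Q) (φ ψ : T.QHat) :
    T.ΩHat χ (φ + ψ) = T.ΩHat χ φ + T.ΩHat χ ψ := by
  simp only [ΩHat, LinearMap.add_apply]
  push_cast
  ring

/-! ### The Gaussian measure on `QHat` -/

/-- The Riesz representation of functionals on `Q` by vectors of `L`. -/
def rieszQ : StrongDual ℝ T.Q →ₗ[ℝ] L where
  toFun l := (InnerProductSpace.toDual ℝ L).symm (l.comp T.q)
  map_add' l l' := by rw [ContinuousLinearMap.add_comp, map_add]
  map_smul' a l := by rw [ContinuousLinearMap.smul_comp]; simp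

theorem inner_rieszQ (l : StrongDual ℝ T.Q) (ξ : L) : ⟪T.rieszQ l, ξ⟫_ℝ = l (T.q ξ) :=
  InnerProductSpace.toDual_symm_apply

theorem rieszQ_gQ (χ : T.Q) : T.rieszQ (T.gQ χ) = T.j χ := by
  refine ext_inner_right ℝ fun ξ => ?_
  rw [T.inner_rieszQ, T.gQ_apply, T.inner_j_j_q]

/-- Ensures that the real coherent states of `coherentS_total` exhaust the exponentials of
evaluations. -/
theorem exists_gQ_eq (l : StrongDual ℝ T.Q) : ∃ χ, T.gQ χ = l := by
  refine ⟨T.q (T.rieszQ l), ?_⟩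
  ext φ
  rw [T.gQ_apply, real_inner_comm, T.inner_j_j_q, real_inner_comm, T.inner_rieszQ, T.q_j]

theorem norm_rieszQ (l : StrongDual ℝ T.Q) : ‖T.rieszQ l‖ = ‖l‖ := by
  refine le_antisymm ?_ (ContinuousLinearMap.opNorm_le_bound _ (norm_nonneg _) fun φ => ?_)
  · change ‖(InnerProductSpace.toDual ℝ L).symm (l.comp T.q)‖ ≤ _
    rw [LinearIsometryEquiv.norm_map]
    refine ContinuousLinearMap.opNorm_le_bound _ (norm_nonneg l) fun x => ?_
    exact (l.le_opNorm _).trans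
      (mul_le_mul_of_nonneg_left (Submodule.Quotient.norm_mk_le T.M x) (norm_nonneg l))
  · have h1 : ‖T.j φ‖ ≤ ‖φ‖ := by
      refine le_of_forall_pos_le_add fun ε hε => ?_
      obtain ⟨ξ, rfl, hξ⟩ := Submodule.Quotient.norm_mk_lt φ hε
      refine le_trans ?_ hξ.le
      exact Submodule.norm_starProjection_apply_le _ ξ
    rw [← T.q_j φ, ← T.inner_rieszQ, T.q_j]
    exact (norm_inner_le_norm _ _).trans (mul_le_mul_of_nonneg_left h1 (norm_nonneg _))

theorem isAlgDualGaussian_νQ : IsAlgDualGaussian T.rieszQ (1 / 2) T.νQ := fun l => by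
  rw [T.νQ_spec l]
  congr 3
  exact NNReal.eq (T.norm_rieszQ l).symm

/-- `Q` is the Cameron–Martin space of `νQ`; the factor `2` compensates the variance factor `½`. -/
theorem inclQ_eq_covariance (χ : T.Q) (l : StrongDual ℝ T.Q) : T.inclQ χ l =
    ((1 / 2 : ℝ≥0) : ℝ) * ⟪T.rieszQ ((2 : ℝ) • T.gQ χ), T.rieszQ l⟫_ℝ := by
  rw [map_smul, T.rieszQ_gQ, real_inner_smul_left, real_inner_comm, T.inner_rieszQ, T.q_j]
  change l χ = _
  push_cast
  ring

/-! ### Schrödinger coherent states -/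

/-- The component in `M` of a vector of `L = J M ⊕ M`. -/
def momentumPart (d : L) : L := d - T.j (T.q d)

theorem momentumPart_mem (d : L) : T.momentumPart d ∈ T.M := T.sub_j_q_mem d

/-- With `d = j (q d) + m`, the bracket with `j (q d)` cancels the imaginary part of `ΩHat (q d)`.
The position part of `d` gives a real exponent and the momentum part a phase. -/
theorem coherentS_eq (η ζ : A) (φ : T.QHat) : T.coherentS η ζ φ =
    Complex.exp (Complex.I * T.θ ζ (η -ᵥ ζ) - 1 / 2 * T.Ω (T.q (η -ᵥ ζ)) (T.q (η -ᵥ ζ))) *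
      Complex.exp (cEval (-T.gQ (T.q (η -ᵥ ζ)))
        (-T.gQ (T.q (T.J (T.momentumPart (η -ᵥ ζ))))) φ) := by
  rw [coherentS, ← Complex.exp_add]
  congr 1
  have h1 : T.brQ (η -ᵥ ζ) = T.brQ (T.j (T.q (η -ᵥ ζ))) + T.brQ (T.momentumPart (η -ᵥ ζ)) := by
    rw [← T.brQ_add, momentumPart, add_sub_cancel]
  rw [h1, T.brQ_of_mem_M (T.momentumPart_mem _), cEval, ΩHat]
  simp only [map_add, map_neg]
  push_cast
  ring

theorem isPolyExp_coherentS (η ζ : A) : IsPolyExp (T.coherentS η ζ) := by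
  rw [funext (T.coherentS_eq η ζ)]
  exact (IsPolyExp.exp _ _).const_mul _

theorem memLp_of_isPolyExp {ψ : T.QHat → ℂ} (h : IsPolyExp ψ) : MemLp ψ 2 T.νQ :=
  (h.hasAllMoments T.isAlgDualGaussian_νQ).memLp_two

theorem memLp_coherentS (η ζ : A) : MemLp (T.coherentS η ζ) 2 T.νQ :=
  T.memLp_of_isPolyExp (T.isPolyExp_coherentS η ζ)

theorem conj_coherentS (η ζ : A) (φ : T.QHat) : starRingEnd ℂ (T.coherentS η ζ φ) =
    starRingEnd ℂ (Complex.exp (Complex.I * T.θ ζ (η -ᵥ ζ) -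
      1 / 2 * T.Ω (T.q (η -ᵥ ζ)) (T.q (η -ᵥ ζ)))) *
      Complex.exp (cEval (-T.gQ (T.q (η -ᵥ ζ)))
        (T.gQ (T.q (T.J (T.momentumPart (η -ᵥ ζ))))) φ) := by
  rw [T.coherentS_eq, map_mul, ← Complex.exp_conj (cEval _ _ _), conj_cEval, neg_neg]

/-- The central computation: the complex Laplace transform evaluates the Gram matrix, and it is the
kernel of the holomorphic side. -/
theorem integral_conj_coherentS_mul (η ζ ζ' : A) :
    ∫ φ, starRingEnd ℂ (T.coherentS η ζ φ) * T.coherentS η ζ' φ ∂T.νQ = T.α ζ' ζ := by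
  have h1 (φ : T.QHat) : starRingEnd ℂ (T.coherentS η ζ φ) * T.coherentS η ζ' φ =
      (starRingEnd ℂ (Complex.exp (Complex.I * T.θ ζ (η -ᵥ ζ) -
        1 / 2 * T.Ω (T.q (η -ᵥ ζ)) (T.q (η -ᵥ ζ)))) *
      Complex.exp (Complex.I * T.θ ζ' (η -ᵥ ζ') -
        1 / 2 * T.Ω (T.q (η -ᵥ ζ')) (T.q (η -ᵥ ζ')))) *
      Complex.exp (cEval (-T.gQ (T.q (η -ᵥ ζ)) + -T.gQ (T.q (η -ᵥ ζ')))
        (T.gQ (T.q (T.J (T.momentumPart (η -ᵥ ζ)))) +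
          -T.gQ (T.q (T.J (T.momentumPart (η -ᵥ ζ'))))) φ) := by
    rw [T.conj_coherentS, T.coherentS_eq, cEval_add, Complex.exp_add]
    ring
  simp only [h1]
  rw [integral_const_mul, T.isAlgDualGaussian_νQ.integral_exp_cEval, ← Complex.exp_conj,
    ← Complex.exp_add, ← Complex.exp_add, α]
  congr 1
  have hz : ζ -ᵥ ζ' = (η -ᵥ ζ') - (η -ᵥ ζ) := (vsub_sub_vsub_cancel_left ζ ζ' η).symm
  have hz1 : ζ -ᵥ η = -(η -ᵥ ζ) := (neg_vsub_eq_vsub_rev η ζ).symm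
  have hz2 : ζ' -ᵥ η = -(η -ᵥ ζ') := (neg_vsub_eq_vsub_rev η ζ').symm
  have hr (v : L) : T.rieszQ (T.gQ (T.q (T.J (T.momentumPart v)))) = T.J (T.momentumPart v) := by
    rw [T.rieszQ_gQ, T.j_q_of_mem_orthogonal (T.J_mem_orthogonal (T.momentumPart_mem v))]
  have hd (v : L) : v = T.j (T.q v) + T.momentumPart v := by rw [momentumPart]; abel
  simp only [hz, T.θ_eq η ζ, T.θ_eq η ζ', hz1, hz2, T.Ω_q, map_add, map_neg, hr]
  simp only [T.rieszQ_gQ]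
  -- What remains is an identity of exponents in four vectors, `a, a'` in `Mᗮ` and `m, m'` in `M`.
  -- Mixed inner products vanish, brackets ending in `M` vanish, and those starting in `M` are inner
  -- products with `J m` or `J m'`.
  generalize η -ᵥ ζ = d
  generalize η -ᵥ ζ' = d'
  have ha := T.j_mem_orthogonal (T.q d)
  have ha' := T.j_mem_orthogonal (T.q d')
  have hm := T.momentumPart_mem d
  have hm' := T.momentumPart_mem d'
  have hb1 := hd d
  have hb2 := hd d'
  revert hb1 hb2
  generalize T.j (T.q d) = a at *
  generalize T.j (T.q d') = a' at *
  generalize T.momentumPart d = m at *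
  generalize T.momentumPart d' = m' at *
  intro hb1 hb2
  subst hb1 hb2
  have o1 : ⟪a, m⟫_ℝ = 0 := by rw [real_inner_comm]; exact ha m hm
  have o2 : ⟪a', m⟫_ℝ = 0 := by rw [real_inner_comm]; exact ha' m hm
  have o3 : ⟪a, m'⟫_ℝ = 0 := by rw [real_inner_comm]; exact ha m' hm'
  have o4 : ⟪a', m'⟫_ℝ = 0 := by rw [real_inner_comm]; exact ha' m' hm'
  rw [← Complex.ofReal_pow, ← Complex.ofReal_pow, ← real_inner_self_eq_norm_sq,
    ← real_inner_self_eq_norm_sq]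
  simp only [map_add, map_sub, add_apply, neg_apply, hm _, hm' _,
    T.br_left_of_mem_M hm, T.br_left_of_mem_M hm', inner_add_left, inner_add_right,
    inner_sub_left, inner_sub_right, inner_neg_left, inner_neg_right, o1, o2, o3, o4, ha _ hm,
    ha' _ hm, ha _ hm', ha' _ hm', T.inner_J_J, T.br_comm_of_mem_orthogonal ha' ha,
    real_inner_comm a a', real_inner_comm (T.J m) a, real_inner_comm (T.J m) a',
    real_inner_comm (T.J m') a, real_inner_comm (T.J m') a', real_inner_comm m m',
    map_mul, Complex.conj_I, Complex.conj_ofReal, map_div₀, map_one, map_ofNat]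
  push_cast
  ring

/-- Coherent states displaced from `η` without momentum component are, up to constants, real
exponentials, and these alone are total. -/
theorem coherentS_total (η : A) (f : Lp ℂ 2 T.νQ)
    (hf : ∀ ζ, ⟪(T.memLp_coherentS η ζ).toLp (T.coherentS η ζ), f⟫_ℂ = 0) : f = 0 := by
  refine Lp.eq_zero_iff_ae_eq_zero.2
    (T.isAlgDualGaussian_νQ.eq_zero_of_integral_exp_eq_zero (Lp.memLp f) fun l => ?_)
  obtain ⟨χ, rfl⟩ := T.exists_gQ_eq l
  have h1 := hf (T.j χ +ᵥ η)
  rw [inner_toLp_eq_integral] at h1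
  have h2 : η -ᵥ (T.j χ +ᵥ η) = -T.j χ := by
    rw [vsub_vadd_eq_vsub_sub, vsub_self, zero_sub]
  have h3 : T.momentumPart (-T.j χ) = 0 := by
    rw [momentumPart, map_neg, T.q_j, map_neg, sub_self]
  have h4 : -T.gQ (T.q (-T.j χ)) = T.gQ χ := by
    ext φ
    rw [neg_apply, T.gQ_apply, T.gQ_apply, map_neg, T.q_j, map_neg, inner_neg_left, neg_neg]
  have h5 : T.gQ (T.q (T.J 0)) = 0 := by
    rw [map_zero, map_zero, ← zero_smul ℝ (0 : T.Q), T.gQ_smul, zero_smul]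
  simp only [T.conj_coherentS, h2, h3, h4, h5, mul_assoc] at h1
  rw [integral_const_mul] at h1
  have h6 := (mul_eq_zero.1 h1).resolve_left (by simp)
  simpa [cEval] using h6

/-! ### The coherent state transform of reduced Schrödinger wave functions -/

/-- The pairing of an `η`-reduced wave function with the coherent states. -/
def waveS (η : A) (ψ : T.QHat → ℂ) (ζ : A) : ℂ :=
  ∫ φ, starRingEnd ℂ (T.coherentS η ζ φ) * ψ φ ∂T.νQ

theorem waveS_eq_inner (η : A) (f : Lp ℂ 2 T.νQ) (ζ : A) :
    T.waveS η f ζ = ⟪(T.memLp_coherentS η ζ).toLp (T.coherentS η ζ), f⟫_ℂ :=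
  (inner_toLp_eq_integral _ f).symm

theorem waveS_congr (η : A) {ψ ψ' : T.QHat → ℂ} (h : ψ =ᵐ[T.νQ] ψ') :
    T.waveS η ψ = T.waveS η ψ' := by
  ext ζ
  refine integral_congr_ae ?_
  filter_upwards [h] with φ h1
  rw [h1]

theorem integrable_conj_coherentS_mul (η ζ : A) {ψ : T.QHat → ℂ} (h : MemLp ψ 2 T.νQ) :
    Integrable (fun φ => starRingEnd ℂ (T.coherentS η ζ φ) * ψ φ) T.νQ :=
  (T.memLp_coherentS η ζ).star.integrable_mul h

theorem waveS_add (η : A) {ψ ψ' : T.QHat → ℂ} (h : MemLp ψ 2 T.νQ) (h' : MemLp ψ' 2 T.νQ) :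
    T.waveS η (ψ + ψ') = T.waveS η ψ + T.waveS η ψ' := by
  ext ζ
  rw [Pi.add_apply, waveS, waveS, waveS, ← integral_add (T.integrable_conj_coherentS_mul η ζ h)
    (T.integrable_conj_coherentS_mul η ζ h')]
  simp only [Pi.add_apply, mul_add]

theorem waveS_smul (η : A) (z : ℂ) (ψ : T.QHat → ℂ) :
    T.waveS η (z • ψ) = z • T.waveS η ψ := by
  ext ζ
  rw [Pi.smul_apply, waveS, waveS, smul_eq_mul, ← integral_const_mul]
  simp only [Pi.smul_apply, smul_eq_mul, mul_left_comm]

theorem waveS_zero (η : A) : T.waveS η 0 = 0 := by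
  ext ζ
  simp [waveS]

theorem waveS_coherentS (η ζ : A) : T.waveS η (T.coherentS η ζ) = T.coherentH ζ := by
  ext ζ'
  rw [waveS, T.integral_conj_coherentS_mul, coherentH]

/-- The generator of translations of the parameter of coherent states. -/
def shiftGen (X : L) (φ : T.QHat) : ℂ := Complex.I * φ (T.brQ X) + T.ΩHat (T.q X) φ

theorem shiftGen_eq (X : L) (φ : T.QHat) : T.shiftGen X φ =
    cEval (T.gQ (T.q X)) (T.gQ (T.q (T.J (T.momentumPart X)))) φ := by
  have h1 : T.brQ X = T.brQ (T.j (T.q X)) + T.brQ (T.momentumPart X) := by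
    rw [← T.brQ_add, momentumPart, add_sub_cancel]
  rw [shiftGen, h1, T.brQ_of_mem_M (T.momentumPart_mem _), cEval, ΩHat, map_add]
  push_cast
  ring

/-- The logarithmic derivative of the constant term of the coherent state of `ζ` along `X`. -/
def shiftConst (η ζ : A) (X : L) : ℂ :=
  Complex.I * T.br X (η -ᵥ ζ) - Complex.I * T.θ ζ X + T.Ω (T.q (η -ᵥ ζ)) (T.q X)

/-- The exponent is quadratic along a line in `A`. Its `t ^ 2` coefficient is free of `φ` and does
not contribute to the derivative at `0`. -/
theorem coherentS_vadd (η ζ : A) (X : L) (t : ℝ) (φ : T.QHat) :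
    T.coherentS η (t • X +ᵥ ζ) φ = Complex.exp (t * T.shiftConst η ζ X +
      t ^ 2 * (-Complex.I * T.br X X - 1 / 2 * T.Ω (T.q X) (T.q X))) *
        (Complex.exp (t * T.shiftGen X φ) * T.coherentS η ζ φ) := by
  have h1 : η -ᵥ (t • X +ᵥ ζ) = (η -ᵥ ζ) + (-t) • X := by
    rw [vsub_vadd_eq_vsub_sub, neg_smul, sub_eq_add_neg]
  rw [coherentS, coherentS, h1, ← Complex.exp_add, ← Complex.exp_add, shiftGen, shiftConst]
  congr 1
  rw [T.θ_vadd]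
  simp only [map_add, map_smul, T.Ω_add_left, T.Ω_add_right, T.Ω_smul_left, T.Ω_smul_right,
    T.brQ_add, T.brQ_smul, T.ΩHat_add_left, T.ΩHat_smul_left, smul_apply, smul_eq_mul,
    T.Ω_comm (T.q X) (T.q (η -ᵥ ζ))]
  push_cast
  ring

/-- Only the coherent state depends on `ζ`, so square integrability of `f` suffices for all
directional derivatives of its transform. -/
theorem hasDerivAt_waveS (η ζ : A) (X : L) {f : T.QHat → ℂ} (hf : MemLp f 2 T.νQ) :
    HasDerivAt (fun t : ℝ => T.waveS η f (t • X +ᵥ ζ))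
      (∫ φ, starRingEnd ℂ (T.coherentS η ζ φ) *
        (starRingEnd ℂ (T.shiftConst η ζ X + T.shiftGen X φ) * f φ) ∂T.νQ) 0 := by
  set κ : ℂ := -Complex.I * T.br X X - 1 / 2 * T.Ω (T.q X) (T.q X)
  set κ₀ : ℂ := starRingEnd ℂ (Complex.exp (Complex.I * T.θ ζ (η -ᵥ ζ) -
      1 / 2 * T.Ω (T.q (η -ᵥ ζ)) (T.q (η -ᵥ ζ)))) with hκ₀
  set a := -T.gQ (T.q (η -ᵥ ζ))
  set b := T.gQ (T.q (T.J (T.momentumPart (η -ᵥ ζ))))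
  set a' := T.gQ (T.q X)
  set b' := -T.gQ (T.q (T.J (T.momentumPart X)))
  have hconj (φ : T.QHat) : starRingEnd ℂ (T.shiftGen X φ) = cEval a' b' φ := by
    rw [T.shiftGen_eq, conj_cEval]
  have hK (φ : T.QHat) : starRingEnd ℂ (T.coherentS η ζ φ) = κ₀ * Complex.exp (cEval a b φ) :=
    T.conj_coherentS η ζ φ
  have d1 := T.isAlgDualGaussian_νQ.hasDerivAt_integral_exp hf a b a' b'
  have d2 : HasDerivAt (fun t : ℝ => Complex.exp (t * starRingEnd ℂ (T.shiftConst η ζ X) +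
      t ^ 2 * starRingEnd ℂ κ)) (starRingEnd ℂ (T.shiftConst η ζ X)) 0 := by
    have h1 := Complex.ofRealCLM.hasDerivAt (x := 0)
    have h2 := ((h1.mul_const (starRingEnd ℂ (T.shiftConst η ζ X))).add
      ((h1.pow 2).mul_const (starRingEnd ℂ κ))).cexp
    refine (h2.congr_deriv ?_)
    simp
  have d3 := d2.mul (d1.const_mul κ₀)
  refine (d3.congr_deriv ?_).congr_of_eventuallyEq (.of_forall fun t => ?_)
  · have i1 : Integrable (fun φ => Complex.exp (cEval a b φ) * f φ) T.νQ :=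
      (T.isAlgDualGaussian_νQ.hasAllMoments_exp a b).memLp_two.integrable_mul hf
    have i2 : Integrable (fun φ => cEval a' b' φ * (Complex.exp (cEval a b φ) * f φ)) T.νQ := by
      refine ((((T.isAlgDualGaussian_νQ.hasAllMoments_cEval a' b').mul
        (T.isAlgDualGaussian_νQ.hasAllMoments_exp a b)).memLp_two).integrable_mul hf).congr
        (.of_forall fun φ => ?_)
      simp only [Pi.mul_apply, mul_assoc]
    simp only [Complex.ofReal_zero, zero_mul, add_zero, ne_eq, OfNat.ofNat_ne_zero,
      not_false_eq_true, zero_pow, Complex.exp_zero, one_mul]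
    rw [← integral_const_mul, ← integral_const_mul, ← integral_const_mul,
      ← integral_add ((i1.const_mul _).const_mul _) (i2.const_mul _)]
    refine integral_congr_ae (.of_forall fun φ => ?_)
    simp only [hK, map_add, hconj]
    ring
  · simp only [waveS, Pi.mul_apply]
    rw [← integral_const_mul, ← integral_const_mul]
    refine integral_congr_ae (.of_forall fun φ => ?_)
    simp only [T.coherentS_vadd, map_mul, hK, ← Complex.exp_conj, map_add, hconj, map_pow,
      Complex.conj_ofReal, Complex.exp_add (cEval a b φ)]
    ring

/-! ### Quantized observables on Schrödinger wave functions -/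

/-- Integration by parts frees `ψ` of its derivative: the Gaussian weight contributes the term with
`gQ`, with factor `2` from the variance `½`, and the conjugated coherent state contributes its
logarithmic derivative. -/
theorem exists_quantS_eq (η : A) (F : A →ᴬ[ℝ] ℝ) {ψ : T.QHat → ℂ} (hψ : IsPolyExp ψ) :
    ∃ ψ' : T.QHat → ℂ, IsPolyExp ψ' ∧
      (∀ φ, HasDerivAt (fun t : ℝ => ψ (φ + t • T.inclQ (T.q (T.X F)))) (ψ' φ) 0) ∧
      ∀ ζ : A, ∫ φ, starRingEnd ℂ (T.coherentS η ζ φ) * ψ' φ ∂T.νQ =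
        ∫ φ, starRingEnd ℂ (T.coherentS η ζ φ) * ((2 * φ (T.gQ (T.q (T.X F))) -
          cEval (-T.gQ (T.q (η -ᵥ ζ))) (T.gQ (T.q (T.J (T.momentumPart (η -ᵥ ζ)))))
            (T.inclQ (T.q (T.X F)))) * ψ φ) ∂T.νQ := by
  obtain ⟨ψ', h1, h2, h3⟩ := hψ.exists_hasDerivAt T.isAlgDualGaussian_νQ (T.inclQ (T.q (T.X F)))
  refine ⟨ψ', h1, h2, fun ζ => ?_⟩
  have h4 := h3 _ (T.inclQ_eq_covariance _) (-T.gQ (T.q (η -ᵥ ζ)))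
    (T.gQ (T.q (T.J (T.momentumPart (η -ᵥ ζ)))))
  set a := -T.gQ (T.q (η -ᵥ ζ))
  set b := T.gQ (T.q (T.J (T.momentumPart (η -ᵥ ζ))))
  set z := cEval a b (T.inclQ (T.q (T.X F)))
  have hexp (g : T.QHat → ℂ) (hg : IsPolyExp g) :
      Integrable (fun φ => Complex.exp (cEval a b φ) * g φ) T.νQ :=
    ((T.isAlgDualGaussian_νQ.hasAllMoments_exp a b).mul
      (hg.hasAllMoments T.isAlgDualGaussian_νQ)).integrable
  simp only [mul_add] at h4
  rw [integral_add (hexp _ h1) (hexp _ (hψ.const_mul z)), ← eq_sub_iff_add_eq,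
    ← integral_sub (hexp _ (hψ.eval_mul _)) (hexp _ (hψ.const_mul z))] at h4
  simp only [T.conj_coherentS, mul_assoc]
  rw [integral_const_mul, integral_const_mul, h4]
  congr 1
  refine integral_congr_ae (.of_forall fun φ => ?_)
  simp only [map_smul, smul_eq_mul]
  push_cast
  ring

theorem isPolyExp_quantS (η : A) (F : A →ᴬ[ℝ] ℝ) {ψ : T.QHat → ℂ} (hψ : IsPolyExp ψ) :
    IsPolyExp (T.quantS η F ψ) := by
  obtain ⟨ψ', h1, h2, -⟩ := T.exists_quantS_eq η F hψ
  have h3 := ((hψ.const_mul (F η)).add ((hψ.eval_mul (T.brQ (T.X F))).const_mul (-1))).add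
    (((hψ.eval_mul (T.gQ (T.q (T.X F)))).const_mul Complex.I).add
      ((hψ.eval_mul (T.brQ (T.j (T.q (T.X F))))).add (h1.const_mul (-Complex.I))))
  convert h3 using 1
  ext φ
  rw [quantS, (h2 φ).deriv, ΩHat]
  linear_combination (-(φ (T.brQ (T.j (T.q (T.X F)))) * ψ φ)) * Complex.I_sq

/-- Needed because `quantS` evaluates `F` at the base point and `quantH` at the argument of the wave
function. -/
theorem map_eq_add_br (η ζ : A) (F : A →ᴬ[ℝ] ℝ) :
    F η = F ζ + (T.br (η -ᵥ ζ) (T.X F) - T.br (T.X F) (η -ᵥ ζ)) := by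
  have h1 : F.contLinear (η -ᵥ ζ) = F η - F ζ := F.toAffineMap.linearMap_vsub η ζ
  have h2 := T.X_spec F (η -ᵥ ζ)
  rw [ω_def, h1] at h2
  linarith

/-- The coherent state transform intertwines the quantized observables. -/
theorem waveS_quantS (η : A) (F : A →ᴬ[ℝ] ℝ) {ψ : T.QHat → ℂ} (hψ : IsPolyExp ψ) :
    T.waveS η (T.quantS η F ψ) = T.quantH F (T.waveS η ψ) := by
  ext ζ
  obtain ⟨ψ', h1, h2, h3⟩ := T.exists_quantS_eq η F hψ
  set X := T.X F with hX
  have hq (φ : T.QHat) : T.quantS η F ψ φ =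
      (F η - φ (T.brQ X) + Complex.I * T.ΩHat (T.q X) φ) * ψ φ - Complex.I * ψ' φ := by
    rw [quantS, (h2 φ).deriv]
  have hcoef : IsPolyExp fun φ => (F η - φ (T.brQ X) + Complex.I * T.ΩHat (T.q X) φ) * ψ φ := by
    have h4 := (T.isPolyExp_quantS η F hψ).add (h1.const_mul Complex.I)
    simp only [hq] at h4
    simpa using h4
  have hibp : IsPolyExp fun φ => (2 * φ (T.gQ (T.q X)) -
      cEval (-T.gQ (T.q (η -ᵥ ζ))) (T.gQ (T.q (T.J (T.momentumPart (η -ᵥ ζ)))))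
        (T.inclQ (T.q X))) * ψ φ := by
    have h4 := ((hψ.eval_mul (T.gQ (T.q X))).const_mul 2).add (hψ.const_mul
      (-cEval (-T.gQ (T.q (η -ᵥ ζ))) (T.gQ (T.q (T.J (T.momentumPart (η -ᵥ ζ)))))
        (T.inclQ (T.q X))))
    convert! h4 using 2
    ring
  have hshift : IsPolyExp fun φ =>
      starRingEnd ℂ (T.shiftConst η ζ X + T.shiftGen X φ) * ψ φ := by
    have h4 := (hψ.const_mul (starRingEnd ℂ (T.shiftConst η ζ X))).add (hψ.cEval_mul
      (T.gQ (T.q X)) (-T.gQ (T.q (T.J (T.momentumPart X)))))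
    convert! h4 using 2
    rw [map_add, T.shiftGen_eq, conj_cEval]
    ring
  have hi (g : T.QHat → ℂ) (hg : IsPolyExp g) :=
    T.integrable_conj_coherentS_mul η ζ (T.memLp_of_isPolyExp hg)
  have hL : T.waveS η (T.quantS η F ψ) ζ =
      ∫ φ, starRingEnd ℂ (T.coherentS η ζ φ) *
        ((F η - φ (T.brQ X) + Complex.I * T.ΩHat (T.q X) φ) * ψ φ) ∂T.νQ -
      Complex.I * ∫ φ, starRingEnd ℂ (T.coherentS η ζ φ) * ψ' φ ∂T.νQ := by
    rw [← integral_const_mul, ← integral_sub (hi _ hcoef) ((hi _ h1).const_mul _), waveS]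
    refine integral_congr_ae (.of_forall fun φ => ?_)
    simp only [hq]
    ring
  -- With `ψ` undifferentiated on both sides, each side is one integral of the conjugated coherent
  -- state times `ψ` times a polynomial of degree one in `φ`. These polynomials agree pointwise.
  rw [hL, h3, quantH, ← hX, (T.hasDerivAt_waveS η ζ X (T.memLp_of_isPolyExp hψ)).deriv, waveS,
    ← integral_const_mul, ← integral_const_mul, ← integral_const_mul,
    ← integral_sub (hi _ hcoef) ((hi _ hibp).const_mul _),
    ← integral_sub ((hi _ hψ).const_mul _) ((hi _ hshift).const_mul _)]
  refine integral_congr_ae (.of_forall fun φ => ?_)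
  simp only []
  have e1 : cEval (-T.gQ (T.q (η -ᵥ ζ))) (T.gQ (T.q (T.J (T.momentumPart (η -ᵥ ζ)))))
      (T.inclQ (T.q X)) = -⟪T.j (T.q (η -ᵥ ζ)), T.j (T.q X)⟫_ℝ +
        Complex.I * T.br (T.momentumPart (η -ᵥ ζ)) X := by
    rw [← T.brQ_of_mem_M (T.momentumPart_mem _), cEval, map_neg]
    push_cast
    rfl
  have e2 : T.br (η -ᵥ ζ) X = T.br (T.j (T.q (η -ᵥ ζ))) X + T.br (T.momentumPart (η -ᵥ ζ)) X := by
    rw [← add_apply, ← map_add, momentumPart, add_sub_cancel]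
  rw [e1, T.map_eq_add_br η ζ F, ← hX, e2, shiftConst, shiftGen, Ω, ΩHat, T.brQ_q]
  simp only [map_add, map_sub, map_mul, Complex.conj_I, Complex.conj_ofReal]
  push_cast
  ring_nf
  simp only [Complex.I_sq]
  ring

/-! ### The generated subspaces -/

theorem isPolyExp_of_mem_HS_c {η : A} {ψ : T.QHat → ℂ} (h : ψ ∈ T.HS_c η) : IsPolyExp ψ := by
  induction h using Submodule.span_induction with
  | mem _ h =>
    obtain ⟨ζ, rfl⟩ := h
    exact T.isPolyExp_coherentS η ζ
  | zero => exact IsPolyExp.zero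
  | add _ _ _ _ h1 h2 => exact h1.add h2
  | smul z _ _ h => exact h.const_mul z

theorem isPolyExp_foldr (η : A) (Fs : List (A →ᴬ[ℝ] ℝ)) {ψ : T.QHat → ℂ} (h : IsPolyExp ψ) :
    IsPolyExp (Fs.foldr (T.quantS η) ψ) := by
  induction Fs with
  | nil => exact h
  | cons F Fs ih => exact T.isPolyExp_quantS η F ih

theorem isPolyExp_of_mem_HS_cp {η : A} {ψ : T.QHat → ℂ} (h : ψ ∈ T.HS_cp η) : IsPolyExp ψ := by
  induction h using Submodule.span_induction with
  | mem _ h =>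
    obtain ⟨Fs, ψ, hψ, rfl⟩ := h
    exact T.isPolyExp_foldr η Fs (T.isPolyExp_of_mem_HS_c hψ)
  | zero => exact IsPolyExp.zero
  | add _ _ _ _ h1 h2 => exact h1.add h2
  | smul z _ _ h => exact h.const_mul z

theorem memLp_of_mem_HS_cp {η : A} {ψ : T.QHat → ℂ} (h : ψ ∈ T.HS_cp η) : MemLp ψ 2 T.νQ :=
  T.memLp_of_isPolyExp (T.isPolyExp_of_mem_HS_cp h)

theorem quantS_mem_HS_cp {η : A} (F : A →ᴬ[ℝ] ℝ) {ψ : T.QHat → ℂ} (h : ψ ∈ T.HS_cp η) :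
    T.quantS η F ψ ∈ T.HS_cp η := by
  -- Linearity of `quantS` on this span relies on existence of the derivatives, as `deriv` takes the
  -- default value `0` where there is none.
  have hd {ψ : T.QHat → ℂ} (h : ψ ∈ T.HS_cp η) (φ : T.QHat) : DifferentiableAt ℝ
      (fun t : ℝ => ψ (φ + t • T.inclQ (T.q (T.X F)))) 0 := by
    obtain ⟨_, -, h1, -⟩ := T.exists_quantS_eq η F (T.isPolyExp_of_mem_HS_cp h)
    exact (h1 φ).differentiableAt
  induction h using Submodule.span_induction with
  | mem _ h =>
    obtain ⟨Fs, ψ, hψ, rfl⟩ := h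
    exact Submodule.subset_span ⟨F :: Fs, ψ, hψ, rfl⟩
  | zero =>
    convert Submodule.zero_mem _
    ext φ
    simp [quantS]
  | add ψ ψ' h h' h1 h2 =>
    convert Submodule.add_mem _ h1 h2 using 1
    ext φ
    simp only [quantS, Pi.add_apply]
    rw [deriv_fun_add (hd h φ) (hd h' φ)]
    ring
  | smul z ψ h h1 =>
    convert Submodule.smul_mem _ z h1 using 1
    ext φ
    simp only [quantS, Pi.smul_apply, smul_eq_mul]
    rw [deriv_const_mul _ (hd h φ)]
    ring

theorem waveS_foldr (η : A) (Fs : List (A →ᴬ[ℝ] ℝ)) {ψ : T.QHat → ℂ} (h : IsPolyExp ψ) :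
    T.waveS η (Fs.foldr (T.quantS η) ψ) = Fs.foldr T.quantH (T.waveS η ψ) := by
  induction Fs with
  | nil => rfl
  | cons F Fs ih =>
    rw [List.foldr_cons, List.foldr_cons, T.waveS_quantS η F (T.isPolyExp_foldr η Fs h), ih]

theorem image_waveS_HS_c (η : A) : T.waveS η '' T.HS_c η = T.HHat_c := by
  refine Set.Subset.antisymm ?_ fun χ hχ => ?_
  · rintro _ ⟨ψ, hψ, rfl⟩
    induction hψ using Submodule.span_induction with
    | mem _ h =>
      obtain ⟨ζ, rfl⟩ := h
      rw [T.waveS_coherentS]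
      exact Submodule.subset_span ⟨ζ, rfl⟩
    | zero => rw [T.waveS_zero]; exact Submodule.zero_mem _
    | add ψ ψ' h h' h1 h2 =>
      rw [T.waveS_add η (T.memLp_of_isPolyExp (T.isPolyExp_of_mem_HS_c h))
        (T.memLp_of_isPolyExp (T.isPolyExp_of_mem_HS_c h'))]
      exact Submodule.add_mem _ h1 h2
    | smul z ψ h h1 => rw [T.waveS_smul]; exact Submodule.smul_mem _ z h1
  · induction hχ using Submodule.span_induction with
    | mem _ h =>
      obtain ⟨ζ, rfl⟩ := h
      exact ⟨_, Submodule.subset_span ⟨ζ, rfl⟩, T.waveS_coherentS η ζ⟩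
    | zero => exact ⟨0, Submodule.zero_mem _, T.waveS_zero η⟩
    | add _ _ _ _ h1 h2 =>
      obtain ⟨ψ, h, rfl⟩ := h1
      obtain ⟨ψ', h', rfl⟩ := h2
      exact ⟨ψ + ψ', Submodule.add_mem _ h h',
        T.waveS_add η (T.memLp_of_isPolyExp (T.isPolyExp_of_mem_HS_c h))
          (T.memLp_of_isPolyExp (T.isPolyExp_of_mem_HS_c h'))⟩
    | smul z _ _ h1 =>
      obtain ⟨ψ, h, rfl⟩ := h1
      exact ⟨z • ψ, Submodule.smul_mem _ z h, T.waveS_smul η z ψ⟩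

theorem image_waveS_HS_cp (η : A) : T.waveS η '' T.HS_cp η = T.HHat_cp := by
  refine Set.Subset.antisymm ?_ fun χ hχ => ?_
  · rintro _ ⟨ψ, hψ, rfl⟩
    induction hψ using Submodule.span_induction with
    | mem _ h =>
      obtain ⟨Fs, ψ, hψ, rfl⟩ := h
      rw [T.waveS_foldr η Fs (T.isPolyExp_of_mem_HS_c hψ)]
      refine Submodule.subset_span ⟨Fs, _, ?_, rfl⟩
      have := Set.mem_image_of_mem (T.waveS η) hψ
      rwa [T.image_waveS_HS_c η] at this
    | zero => rw [T.waveS_zero]; exact Submodule.zero_mem _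
    | add ψ ψ' h h' h1 h2 =>
      rw [T.waveS_add η (T.memLp_of_mem_HS_cp h) (T.memLp_of_mem_HS_cp h')]
      exact Submodule.add_mem _ h1 h2
    | smul z ψ h h1 => rw [T.waveS_smul]; exact Submodule.smul_mem _ z h1
  · induction hχ using Submodule.span_induction with
    | mem _ h =>
      obtain ⟨Fs, χ, hχ, rfl⟩ := h
      obtain ⟨ψ, hψ, rfl⟩ : χ ∈ T.waveS η '' T.HS_c η := by rw [T.image_waveS_HS_c η]; exact hχ
      exact ⟨_, Submodule.subset_span ⟨Fs, ψ, hψ, rfl⟩,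
        T.waveS_foldr η Fs (T.isPolyExp_of_mem_HS_c hψ)⟩
    | zero => exact ⟨0, Submodule.zero_mem _, T.waveS_zero η⟩
    | add _ _ _ _ h1 h2 =>
      obtain ⟨ψ, h, rfl⟩ := h1
      obtain ⟨ψ', h', rfl⟩ := h2
      exact ⟨ψ + ψ', Submodule.add_mem _ h h',
        T.waveS_add η (T.memLp_of_mem_HS_cp h) (T.memLp_of_mem_HS_cp h')⟩
    | smul z _ _ h1 =>
      obtain ⟨ψ, h, rfl⟩ := h1
      exact ⟨z • ψ, Submodule.smul_mem _ z h, T.waveS_smul η z ψ⟩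

/-! ### Change of base point -/

/-- Coherent states obey the transformation law imposed on all states; this is what makes their
transforms independent of the base point. -/
theorem coherentS_change_base (η η' ζ : A) (φ : T.QHat) : T.coherentS η' ζ φ =
    T.coherentS η ζ (φ + T.inclQ (T.q (η' -ᵥ η))) * T.coherentS η' η φ := by
  have h1 : η' -ᵥ ζ = (η -ᵥ ζ) + (η' -ᵥ η) := by rw [add_comm, vsub_add_vsub_cancel]
  rw [coherentS, coherentS, coherentS, ← Complex.exp_add, h1, T.θ_eq ζ η]
  congr 1
  have h2 : T.inclQ (T.q (η' -ᵥ η)) (T.brQ (η -ᵥ ζ)) = T.br (η -ᵥ ζ) (η' -ᵥ η) := rfl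
  simp only [map_add, T.Ω_add_left, T.Ω_add_right, T.brQ_add, T.ΩHat_add_left, T.ΩHat_add_right,
    T.ΩHat_incl, LinearMap.add_apply, h2, T.Ω_comm (T.q (η' -ᵥ η)) (T.q (η -ᵥ ζ))]
  push_cast
  ring

theorem norm_coherentS (η ζ : A) (φ : T.QHat) : ‖T.coherentS η ζ φ‖ =
    Real.exp (-(‖T.j (T.q (η -ᵥ ζ))‖ ^ 2 / 2) - φ (T.gQ (T.q (η -ᵥ ζ)))) := by
  rw [T.coherentS_eq, norm_mul, norm_exp_cEval, Complex.norm_exp, ← Real.exp_add]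
  have h1 : (T.Ω (T.q (η -ᵥ ζ)) (T.q (η -ᵥ ζ))).re = ‖T.j (T.q (η -ᵥ ζ))‖ ^ 2 := by
    rw [T.Ω_q, Complex.sub_re, Complex.I_mul_re, Complex.ofReal_re, Complex.ofReal_im, neg_zero,
      sub_zero, real_inner_self_eq_norm_sq]
  rw [Complex.sub_re, Complex.I_mul_re, Complex.ofReal_im,
    show (1 / 2 : ℂ) = ((1 / 2 : ℝ) : ℂ) by push_cast; rfl, Complex.re_ofReal_mul, h1,
    map_neg]
  ring_nf

/-- The Cameron–Martin density of the translation by `q (η' -ᵥ η)` is the inverse of the translated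
squared modulus of the coherent state, so changing the base point is isometric. -/
theorem exp_mul_normSq_coherentS (η η' : A) (φ : T.QHat) :
    (Real.exp (φ ((2 : ℝ) • T.gQ (T.q (η' -ᵥ η))) - ((1 / 2 : ℝ≥0) : ℝ) *
      ‖T.rieszQ ((2 : ℝ) • T.gQ (T.q (η' -ᵥ η)))‖ ^ 2 / 2) : ℂ) *
      (‖T.coherentS η' η (φ - T.inclQ (T.q (η' -ᵥ η)))‖ ^ 2 : ℝ) = 1 := by
  have h1 : T.inclQ (T.q (η' -ᵥ η)) (T.gQ (T.q (η' -ᵥ η))) = ‖T.j (T.q (η' -ᵥ η))‖ ^ 2 :=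
    real_inner_self_eq_norm_sq _
  rw [T.norm_coherentS, LinearMap.sub_apply, h1, map_smul, map_smul, T.rieszQ_gQ, norm_smul,
    ← Real.exp_nat_mul, ← Complex.ofReal_mul, ← Real.exp_add, Complex.ofReal_eq_one,
    Real.exp_eq_one_iff]
  push_cast
  rw [smul_eq_mul, Real.norm_ofNat]
  ring

theorem integral_comp_add_mul_normSq (η η' : A) (G : T.QHat → ℂ) :
    ∫ φ, G (φ + T.inclQ (T.q (η' -ᵥ η))) * (‖T.coherentS η' η φ‖ ^ 2 : ℝ) ∂T.νQ =
      ∫ φ, G φ ∂T.νQ := by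
  have h1 := T.isAlgDualGaussian_νQ.integral_comp_shift
    (T.inclQ_eq_covariance (T.q (η' -ᵥ η)))
    (fun φ => G φ * (‖T.coherentS η' η (φ - T.inclQ (T.q (η' -ᵥ η)))‖ ^ 2 : ℝ))
  simp only [add_sub_cancel_right] at h1
  rw [h1]
  refine integral_congr_ae (.of_forall fun φ => ?_)
  simp only []
  rw [mul_left_comm, T.exp_mul_normSq_coherentS, mul_one]

theorem integrable_comp_add_mul_normSq (η η' : A) {G : T.QHat → ℂ} (hG : Integrable G T.νQ) :
    Integrable (fun φ => G (φ + T.inclQ (T.q (η' -ᵥ η))) *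
      (‖T.coherentS η' η φ‖ ^ 2 : ℝ)) T.νQ := by
  have h1 := (T.isAlgDualGaussian_νQ.integrable_comp_shift
    (T.inclQ_eq_covariance (T.q (η' -ᵥ η)))
    (fun φ => G φ * (‖T.coherentS η' η (φ - T.inclQ (T.q (η' -ᵥ η)))‖ ^ 2 : ℝ))).2 ?_
  · simpa only [add_sub_cancel_right] using h1
  · refine (hG.const_mul (Real.exp (((1 / 2 : ℝ≥0) : ℝ) *
      ‖T.rieszQ ((2 : ℝ) • T.gQ (T.q (η' -ᵥ η)))‖ ^ 2 / 2) : ℂ)).congr (.of_forall fun φ => ?_)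
    simp only []
    have h2 := T.exp_mul_normSq_coherentS η η' φ
    generalize ((1 / 2 : ℝ≥0) : ℝ) * ‖T.rieszQ ((2 : ℝ) • T.gQ (T.q (η' -ᵥ η)))‖ ^ 2 / 2 = s at h2 ⊢
    rw [sub_eq_add_neg, Real.exp_add, Complex.ofReal_mul] at h2
    have h3 : (Real.exp s : ℂ) * Real.exp (-s) = 1 := by
      rw [← Complex.ofReal_mul, ← Real.exp_add, add_neg_cancel, Real.exp_zero, Complex.ofReal_one]
    linear_combination (-G φ * Real.exp s) * h2 + (Real.exp (φ ((2 : ℝ) • T.gQ (T.q (η' -ᵥ η)))) *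
      (‖T.coherentS η' η (φ - T.inclQ (T.q (η' -ᵥ η)))‖ ^ 2 : ℝ) * G φ) * h3

theorem memLp_change_base (η η' : A) (ψ : Lp ℂ 2 T.νQ) :
    MemLp (fun φ => ψ (φ + T.inclQ (T.q (η' -ᵥ η))) * T.coherentS η' η φ) 2 T.νQ := by
  have hm : AEStronglyMeasurable
      (fun φ => ψ (φ + T.inclQ (T.q (η' -ᵥ η))) * T.coherentS η' η φ) T.νQ :=
    ((Lp.stronglyMeasurable ψ).comp_measurable
      (algDualShift (T.inclQ (T.q (η' -ᵥ η)))).measurable).aestronglyMeasurable.mul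
      (T.memLp_coherentS η' η).1
  rw [memLp_two_iff_integrable_sq_norm hm]
  have h1 : Integrable (fun φ => ((‖ψ φ‖ ^ 2 : ℝ) : ℂ)) T.νQ :=
    ((memLp_two_iff_integrable_sq_norm (Lp.stronglyMeasurable ψ).aestronglyMeasurable).1
      (Lp.memLp ψ)).ofReal
  have h2 := (T.integrable_comp_add_mul_normSq η η' h1).re
  refine h2.congr (.of_forall fun φ => ?_)
  simp only [← Complex.ofReal_mul, RCLike.re_to_complex, Complex.ofReal_re, norm_mul, mul_pow]

/-- The coherent state and `ψ` each acquire the same factor; one is conjugated, so a squared modulus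
appears and is absorbed by the translation. -/
theorem waveS_change_base (η η' : A) (ψ : T.QHat → ℂ) :
    T.waveS η' (fun φ => ψ (φ + T.inclQ (T.q (η' -ᵥ η))) * T.coherentS η' η φ) =
      T.waveS η ψ := by
  ext ζ
  rw [waveS, waveS, ← T.integral_comp_add_mul_normSq η η'
    (fun φ => starRingEnd ℂ (T.coherentS η ζ φ) * ψ φ)]
  refine integral_congr_ae (.of_forall fun φ => ?_)
  simp only []
  rw [T.coherentS_change_base η η' ζ φ, map_mul, Complex.ofReal_pow, ← Complex.conj_mul']
  ring

/-! ### The isomorphism of the representations -/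

theorem exists_isCoherentIso : ∃ B : A → (Lp ℂ 2 T.νQ ≃ₗᵢ[ℂ] T.H2), T.IsCoherentIso B := by
  have h (η : A) := exists_linearIsometryEquiv_of_inner_eq
    (fun ζ => (T.memLp_coherentS η ζ).toLp (T.coherentS η ζ)) (T.coherentH2At η)
    (T.coherentS_total η) (T.coherentH2At_total η) fun ζ ζ' => by
      rw [inner_toLp_toLp_eq_integral, T.integral_conj_coherentS_mul, T.inner_coherentH2At]
  choose B hB using h
  exact ⟨B, fun η ζ => ⟨T.memLp_coherentS η ζ, by rw [hB, T.waveH_coherentH2At]⟩⟩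

/-- A unitary that preserves coherent states preserves pairings with them. Hence `B η` is determined
by `waveS`, which also gives uniqueness. -/
theorem IsCoherentIso.waveH_eq {T : AffineFieldTheory L A}
    {B : A → (Lp ℂ 2 T.νQ ≃ₗᵢ[ℂ] T.H2)} (hB : T.IsCoherentIso B) (η : A) (f : Lp ℂ 2 T.νQ) :
    T.waveH η (B η f) = T.waveS η f := by
  ext ζ
  obtain ⟨h, h1⟩ := hB η ζ
  rw [← T.waveH_coherentH2At η ζ] at h1
  rw [T.waveH_eq_inner, ← T.waveH_injective η h1, (B η).inner_map_map, T.waveS_eq_inner]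

theorem IsCoherentIso.unique {T : AffineFieldTheory L A}
    {B B' : A → (Lp ℂ 2 T.νQ ≃ₗᵢ[ℂ] T.H2)} (hB : T.IsCoherentIso B) (hB' : T.IsCoherentIso B') :
    B = B' := by
  ext1 η
  ext1 f
  refine T.waveH_injective η ?_
  rw [hB.waveH_eq, hB'.waveH_eq]

end AffineFieldTheory

end

/-! ### Equivalence of the representations and of their observables -/

theorem mainTheorem12 {L A : Type*} [NormedAddCommGroup L] [InnerProductSpace ℝ L]
    [CompleteSpace L] [TopologicalSpace.SeparableSpace L] [MetricSpace A] [NormedAddTorsor L A]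
    (T : AffineFieldTheory L A) :
    -- restriction to `L` is evaluation on holomorphic cylinder functions
    (∀ (p : T.LHat → ℂ) (f : T.H2), T.IsCylinderHolomorphic p →
      (f : Lp ℂ 2 T.νL) =ᵐ[T.νL] p → ∀ ξ : L, T.restrictL f ξ = p (T.inclL ξ)) ∧
    -- the Hilbert space of wave functions on `A` does not depend on the base point
    (∀ η : A, Set.BijOn (T.waveH η) Set.univ T.HHat) ∧
    (∀ (η η' : A) (f f' : T.H2), T.waveH η f = T.waveH η' f' → ‖f‖ = ‖f'‖) ∧
    -- the isomorphism preserving coherent states exists and is unique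
    (∃! B : A → (Lp ℂ 2 T.νQ ≃ₗᵢ[ℂ] T.H2), T.IsCoherentIso B) ∧
    ∀ B : A → (Lp ℂ 2 T.νQ ≃ₗᵢ[ℂ] T.H2), T.IsCoherentIso B →
      -- it does not depend on the base point
      (∀ (η η' : A) (ψ : Lp ℂ 2 T.νQ), ∃ ψ' : Lp ℂ 2 T.νQ,
        (ψ' =ᵐ[T.νQ] fun φ => ψ (φ + T.inclQ (T.q (η' -ᵥ η))) * T.coherentS η' η φ) ∧
          T.waveH η' (B η' ψ') = T.waveH η (B η ψ)) ∧
      ∀ η : A,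
        -- the generated subspaces consist of states on which the observables act
        (∀ ψ ∈ T.HS_cp η, MemLp ψ 2 T.νQ ∧
          ∀ (φ : T.QHat) (χ : T.Q), DifferentiableAt ℝ (fun t : ℝ => ψ (φ + t • T.inclQ χ)) 0) ∧
        (∀ ψ ∈ T.HHat_cp, ψ ∈ T.HHat ∧
          ∀ (ζ : A) (ξ : L), DifferentiableAt ℝ (fun t : ℝ => ψ (t • ξ +ᵥ ζ)) 0) ∧
        (∀ (F : A →ᴬ[ℝ] ℝ), ∀ ψ ∈ T.HS_cp η, T.quantS η F ψ ∈ T.HS_cp η) ∧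
        (∀ (F : A →ᴬ[ℝ] ℝ), ∀ ψ ∈ T.HHat_cp, T.quantH F ψ ∈ T.HHat_cp) ∧
        -- the isomorphism restricts to these subspaces
        Set.BijOn (fun f => T.waveH η (B η f)) (T.HS_cpL2 η) T.HHat_cp ∧
        -- and intertwines the quantized observables
        (∀ (F : A →ᴬ[ℝ] ℝ), ∀ ψ ∈ T.HS_cp η, ∃ (h : MemLp ψ 2 T.νQ)
          (hF : MemLp (T.quantS η F ψ) 2 T.νQ),
          T.waveH η (B η (hF.toLp (T.quantS η F ψ))) =
            T.quantH F (T.waveH η (B η (h.toLp ψ)))) := by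
  refine ⟨fun p f hp hf => T.restrictL_eq_of_cylinder hp hf, T.bijOn_waveH,
    fun η η' f f' h => T.norm_eq_of_waveH_eq h, ?_, fun B hB => ⟨fun η η' ψ => ?_, fun η => ?_⟩⟩
  · obtain ⟨B, hB⟩ := T.exists_isCoherentIso
    exact ⟨B, hB, fun B' hB' => hB'.unique hB⟩
  · have h := T.memLp_change_base η η' ψ
    refine ⟨h.toLp _, h.coeFn_toLp, ?_⟩
    rw [hB.waveH_eq, hB.waveH_eq, T.waveS_congr η' h.coeFn_toLp, T.waveS_change_base]
  have htoLp {ψ : T.QHat → ℂ} (h : MemLp ψ 2 T.νQ) :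
      T.waveH η (B η (h.toLp ψ)) = T.waveS η ψ := by
    rw [hB.waveH_eq, T.waveS_congr η h.coeFn_toLp]
  -- Every element of `HHat_cp` is the transform of a polynomial times exponential function, so its
  -- properties can be read off from the Schrödinger side.
  have hcp {χ : A → ℂ} (hχ : χ ∈ T.HHat_cp) : ∃ ψ ∈ T.HS_cp η, T.waveS η ψ = χ := by
    have h : χ ∈ (T.HHat_cp : Set (A → ℂ)) := hχ
    rwa [← T.image_waveS_HS_cp η] at h
  have hcp' {ψ : T.QHat → ℂ} (hψ : ψ ∈ T.HS_cp η) : T.waveS η ψ ∈ T.HHat_cp := by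
    have h := Set.mem_image_of_mem (T.waveS η) hψ
    rwa [T.image_waveS_HS_cp η] at h
  refine ⟨fun ψ hψ => ⟨T.memLp_of_mem_HS_cp hψ, fun φ χ => ?_⟩, fun χ hχ => ?_,
    fun F ψ hψ => T.quantS_mem_HS_cp F hψ, fun F χ hχ => ?_, ⟨?_, ?_, ?_⟩, fun F ψ hψ => ?_⟩
  · obtain ⟨_, -, h, -⟩ := (T.isPolyExp_of_mem_HS_cp hψ).exists_hasDerivAt
      T.isAlgDualGaussian_νQ (T.inclQ χ)
    exact (h φ).differentiableAt
  · obtain ⟨ψ, hψ, rfl⟩ := hcp hχ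
    have h := T.memLp_of_mem_HS_cp hψ
    exact ⟨⟨η, B η (h.toLp ψ), (htoLp h).symm⟩,
      fun ζ ξ => (T.hasDerivAt_waveS η ζ ξ h).differentiableAt⟩
  · obtain ⟨ψ, hψ, rfl⟩ := hcp hχ
    -- Invariance of `HHat_cp` is transported from `HS_cp η` by the intertwining relation, without a
    -- separate study of `quantH` on sums.
    rw [← T.waveS_quantS η F (T.isPolyExp_of_mem_HS_cp hψ)]
    exact hcp' (T.quantS_mem_HS_cp F hψ)
  · rintro f ⟨ψ, hψ, hf⟩
    change T.waveH η (B η f) ∈ T.HHat_cp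
    rw [hB.waveH_eq, T.waveS_congr η hf]
    exact hcp' hψ
  · exact fun f _ f' _ h => (B η).injective (T.waveH_injective η h)
  · intro χ hχ
    obtain ⟨ψ, hψ, rfl⟩ := hcp hχ
    have h := T.memLp_of_mem_HS_cp hψ
    exact ⟨h.toLp ψ, ⟨ψ, hψ, h.coeFn_toLp⟩, htoLp h⟩
  · have h := T.memLp_of_mem_HS_cp hψ
    refine ⟨h, T.memLp_of_mem_HS_cp (T.quantS_mem_HS_cp F hψ), ?_⟩
    rw [htoLp, htoLp, T.waveS_quantS η F (T.isPolyExp_of_mem_HS_cp hψ)]
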